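/- Let $A,B,C,D$ be real matrices of sizes $m\times m$, $m\times n$, $n\times m$, $n\times n$, and put \[ K=\begin{bmatrix} D & -C\\ -B & A\end{bmatrix},\qquad H=\begin{bmatrix} D & -C\\ B & -A\end{bmatrix}. \] A real square matrix is called a $Z$-matrix if all its off-diagonal entries are nonpositive. A $Z$-matrix $M$ is called an $M$-matrix if $M=sI-N$ for some real number $s$ and some entrywise nonnegative matrix $N$ with $s\ge\rho(N)$, where $\rho$ is the spectral radius. An $M$-matrix $M$ is called regular if $Mv\ge 0$ entrywise for some entrywise positive vector $v$. Suppose that $K$ is a regular $M$-matrix and that all (complex) eigenvalues of $H$ are simple, i.e. have algebraic multiplicity one. Then the algebraic Riccati equation \[ XCX-XD-AX+B=0 \] has at most two solutions $X\in\mathbb R^{m\times n}$ all of whose entries are positive. -/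

import Mathlib

open scoped Matrix

/-- A `Z`-matrix: a real square matrix whose off-diagonal entries are all nonpositive. -/
def IsZMatrix {ι : Type*} (A : Matrix ι ι ℝ) : Prop :=
  ∀ i j, i ≠ j → A i j ≤ 0

/-- The spectral radius of a real square matrix, i.e. the largest modulus of its complex
eigenvalues. -/
noncomputable def matrixSpectralRadius {ι : Type*} [Fintype ι] [DecidableEq ι]
    (A : Matrix ι ι ℝ) : ENNReal :=
  spectralRadius ℂ (A.map Complex.ofReal)

/-- An `M`-matrix: a `Z`-matrix of the form `s I - N` with `N` entrywise nonnegative and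
`s ≥ ρ(N)`. The inequality lives in `ENNReal`, so that `0 ≤ s` is recorded separately. -/
def IsMMatrix {ι : Type*} [Fintype ι] [DecidableEq ι] (A : Matrix ι ι ℝ) : Prop :=
  IsZMatrix A ∧
    ∃ (s : ℝ) (N : Matrix ι ι ℝ), (∀ i j, 0 ≤ N i j) ∧
      A = s • (1 : Matrix ι ι ℝ) - N ∧ 0 ≤ s ∧ matrixSpectralRadius N ≤ ENNReal.ofReal s

/-- A regular `M`-matrix: an `M`-matrix `A` with `A v ≥ 0` for some entrywise positive `v`. -/
def IsRegularMMatrix {ι : Type*} [Fintype ι] [DecidableEq ι] (A : Matrix ι ι ℝ) : Prop :=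
  IsMMatrix A ∧ ∃ v : ι → ℝ, (∀ i, 0 < v i) ∧ ∀ i, 0 ≤ (A *ᵥ v) i

/-- All complex eigenvalues of the real matrix `A` are simple, i.e. have algebraic multiplicity
one. -/
def HasSimpleEigenvalues {ι : Type*} [Fintype ι] [DecidableEq ι] (A : Matrix ι ι ℝ) : Prop :=
  ∀ μ ∈ spectrum ℂ (A.map Complex.ofReal),
    (A.map Complex.ofReal).charpoly.rootMultiplicity μ = 1

/-- The block matrix `K` with rows `[D, -C]` and `[-B, A]`. -/
def riccatiK {m n : ℕ} (A : Matrix (Fin m) (Fin m) ℝ) (B : Matrix (Fin m) (Fin n) ℝ)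
    (C : Matrix (Fin n) (Fin m) ℝ) (D : Matrix (Fin n) (Fin n) ℝ) :
    Matrix (Fin n ⊕ Fin m) (Fin n ⊕ Fin m) ℝ :=
  Matrix.fromBlocks D (-C) (-B) A

/-- The block matrix `H` with rows `[D, -C]` and `[B, -A]`. -/
def riccatiH {m n : ℕ} (A : Matrix (Fin m) (Fin m) ℝ) (B : Matrix (Fin m) (Fin n) ℝ)
    (C : Matrix (Fin n) (Fin m) ℝ) (D : Matrix (Fin n) (Fin n) ℝ) :
    Matrix (Fin n ⊕ Fin m) (Fin n ⊕ Fin m) ℝ :=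
  Matrix.fromBlocks D (-C) B (-A)

/-- The algebraic Riccati equation `X C X - X D - A X + B = 0` in a real `m × n` matrix `X`. -/
def IsRiccatiSolution {m n : ℕ} (A : Matrix (Fin m) (Fin m) ℝ) (B : Matrix (Fin m) (Fin n) ℝ)
    (C : Matrix (Fin n) (Fin m) ℝ) (D : Matrix (Fin n) (Fin n) ℝ)
    (X : Matrix (Fin m) (Fin n) ℝ) : Prop :=
  X * C * X - X * D - A * X + B = 0

/-! Let S = diag(I, -I). Then H = S K, and μ is an eigenvalue of H exactly when K - μS is singular.
The set of real t for which the Z-matrix K - tS has nonnegative smallest eigenvalue is convex, and H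
has no eigenvalue, real or not, whose real part lies strictly between two of its points
(`riccatiH_charpoly_eval_ne_zero`).

Suppose the off-diagonal entries of K are negative. A positive solution X gives Perron vectors u of
D - CX (value d) and w of (A - XC)ᵀ (value a). Then (u, Xu) is a positive kernel vector of K - dS,
and (Xᵀw, w) a positive left kernel vector of K + aS. So d and -a are eigenvalues of H inside the
convex set, which leaves at most two possible values. If the Sylvester operator Δ ↦ (A - XC)Δ + Δ(D
- CX) is injective, then d ≠ -a, so d determines a. The pair (d, a) determines X
(`IsRiccatiPerronPair.eq_of_eq`): a nonzero difference of two solutions would create an eigenvalue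
of H with real part strictly between d and -a. Hence there are at most two solutions.

For general K, simplicity of the eigenvalues of H makes the Sylvester operator injective at every
solution. By an implicit function argument, three positive solutions would survive lowering all
entries of K by a small ε > 0, which contradicts the strict case. -/

theorem IsZMatrix.transpose {ι : Type*} {M : Matrix ι ι ℝ} (hM : IsZMatrix M) : IsZMatrix Mᵀ :=
  fun i j hij => hM j i hij.symm

theorem IsZMatrix.add_smul_one {ι : Type*} [DecidableEq ι] {M : Matrix ι ι ℝ} (hM : IsZMatrix M) (t : ℝ) :
    IsZMatrix (M + t • (1 : Matrix ι ι ℝ)) := by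
  intro i j hij
  simpa [Matrix.one_apply_ne hij] using hM i j hij

/-! ### Semipositive Z-matrices (nonsingular M-matrices). -/

section SemipositiveMatrices

variable {ι : Type*} [Fintype ι]

/-- A semipositive matrix: a real square matrix that maps some positive vector to a positive
vector. -/
def IsSemipositive (M : Matrix ι ι ℝ) : Prop :=
  ∃ v : ι → ℝ, (∀ i, 0 < v i) ∧ ∀ i, 0 < (M *ᵥ v) i

variable [DecidableEq ι]

theorem mulVec_eq_diag_add {R : Type*} [CommRing R] (M : Matrix ι ι R) (v : ι → R) (i : ι) :
    (M *ᵥ v) i = M i i * v i + ∑ j ∈ Finset.univ.erase i, M i j * v j := by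
  simp only [Matrix.mulVec, dotProduct]
  rw [Finset.add_sum_erase _ (fun j => M i j * v j) (Finset.mem_univ i)]

/-- Scaling column j by v j reduces this to strict diagonal dominance. -/
theorem det_ne_zero_of_weighted_row_sum_lt (M : Matrix ι ι ℂ) (v : ι → ℝ) (hv : ∀ i, 0 < v i)
    (h : ∀ i, ∑ j ∈ Finset.univ.erase i, ‖M i j‖ * v j < ‖M i i‖ * v i) : M.det ≠ 0 := by
  have h1 : (M * Matrix.diagonal (fun i => (v i : ℂ))).det ≠ 0 := by
    apply det_ne_zero_of_sum_row_lt_diag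
    intro k
    have := h k
    simpa [Matrix.mul_diagonal, abs_of_pos (hv _)] using this
  rw [Matrix.det_mul] at h1
  exact left_ne_zero_of_mul h1

/-- Semipositivity is weighted diagonal dominance, and a diagonal shift with nonnegative real part
preserves it. Complex shifts are what give control of nonreal eigenvalues. -/
theorem IsZMatrix.det_add_diagonal_ne_zero {M : Matrix ι ι ℝ} (hM : IsZMatrix M)
    (hs : IsSemipositive M) (d : ι → ℂ) (hd : ∀ i, 0 ≤ (d i).re) :
    (M.map Complex.ofReal + Matrix.diagonal d).det ≠ 0 := by
  obtain ⟨v, hv, hMv⟩ := hs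
  refine det_ne_zero_of_weighted_row_sum_lt _ v hv fun i => ?_
  have h1 := hMv i
  rw [mulVec_eq_diag_add] at h1
  have h2 : ∑ j ∈ Finset.univ.erase i,
      ‖(M.map Complex.ofReal + Matrix.diagonal d) i j‖ * v j
      = - ∑ j ∈ Finset.univ.erase i, M i j * v j := by
    rw [← Finset.sum_neg_distrib]
    refine Finset.sum_congr rfl fun j hj => ?_
    have hij : i ≠ j := (Finset.ne_of_mem_erase hj).symm
    simp [Matrix.diagonal_apply_ne _ hij, abs_of_nonpos (hM i j hij)]
  rw [h2]
  have h3 : M i i ≤ ‖(M.map Complex.ofReal + Matrix.diagonal d) i i‖ := by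
    refine le_trans ?_ (Complex.re_le_norm _)
    simp [hd i]
  have := mul_le_mul_of_nonneg_right h3 (hv i).le
  linarith

theorem IsZMatrix.det_ne_zero {M : Matrix ι ι ℝ} (hM : IsZMatrix M)
    (hs : IsSemipositive M) : M.det ≠ 0 := by
  have h := hM.det_add_diagonal_ne_zero hs 0 (by simp)
  rw [Pi.zero_def, Matrix.diagonal_zero, add_zero] at h
  intro h0
  apply h
  have := RingHom.map_det Complex.ofRealHom M
  rw [h0, map_zero] at this
  exact this.symm

/-- If the least ratio r = x k / v k were negative, x - r v would be nonnegative and vanish at k, so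
its image would be nonpositive there; but that entry is (M x) k - r (M v) k > 0. -/
theorem IsZMatrix.nonneg_of_mulVec_nonneg {M : Matrix ι ι ℝ} (hM : IsZMatrix M)
    (hs : IsSemipositive M) {x : ι → ℝ} (hx : ∀ i, 0 ≤ (M *ᵥ x) i) (i : ι) : 0 ≤ x i := by
  classical
  obtain ⟨v, hv, hMv⟩ := hs
  by_contra! hi
  obtain ⟨k, -, hk⟩ := Finset.exists_min_image Finset.univ (fun j => x j / v j)
    ⟨i, Finset.mem_univ i⟩
  set r := x k / v k with hr
  have hr0 : r < 0 := lt_of_le_of_lt (hk i (Finset.mem_univ i)) (div_neg_of_neg_of_pos hi (hv i))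
  have h1 : (M *ᵥ (x - r • v)) k ≤ 0 := by
    rw [mulVec_eq_diag_add]
    have h2 : (x - r • v) k = 0 := by
      simp [hr, (hv k).ne']
    rw [h2, mul_zero, zero_add]
    refine Finset.sum_nonpos fun j hj => ?_
    refine mul_nonpos_of_nonpos_of_nonneg (hM k j (Finset.ne_of_mem_erase hj).symm) ?_
    have := (le_div_iff₀ (hv j)).1 (hk j (Finset.mem_univ j))
    simp only [Pi.sub_apply, Pi.smul_apply, smul_eq_mul]
    linarith
  rw [Matrix.mulVec_sub, Matrix.mulVec_smul] at h1
  simp only [Pi.sub_apply, Pi.smul_apply, smul_eq_mul] at h1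
  nlinarith [hx k, hMv k]

theorem IsZMatrix.isSemipositive_of_nonneg {M : Matrix ι ι ℝ} (hM : IsZMatrix M) {v : ι → ℝ}
    (hv : ∀ i, 0 ≤ v i) (hMv : ∀ i, 0 < (M *ᵥ v) i) : IsSemipositive M := by
  refine ⟨v, fun i => (hv i).lt_of_ne fun h => ?_, hMv⟩
  have h1 := hMv i
  rw [mulVec_eq_diag_add, ← h, mul_zero, zero_add] at h1
  refine absurd h1 (not_lt.2 (Finset.sum_nonpos fun j hj => ?_))
  exact mul_nonpos_of_nonpos_of_nonneg (hM i j (Finset.ne_of_mem_erase hj).symm) (hv j)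

/-- The inverse is entrywise nonnegative, so its column sums form a nonnegative vector that Mᵀ maps
to the all-ones vector. -/
theorem IsZMatrix.isSemipositive_transpose {M : Matrix ι ι ℝ} (hM : IsZMatrix M)
    (hs : IsSemipositive M) : IsSemipositive Mᵀ := by
  have hu : IsUnit M.det := isUnit_iff_ne_zero.2 (hM.det_ne_zero hs)
  have hinv : ∀ i j, 0 ≤ M⁻¹ i j := by
    intro i j
    have : 0 ≤ (M⁻¹ *ᵥ Pi.single j 1) i := by
      refine hM.nonneg_of_mulVec_nonneg hs (fun k => ?_) i
      rw [Matrix.mulVec_mulVec, Matrix.mul_nonsing_inv _ hu, Matrix.one_mulVec]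
      by_cases h : k = j <;> simp [h]
    simpa using this
  refine hM.transpose.isSemipositive_of_nonneg (v := (M⁻¹)ᵀ *ᵥ 1) (fun i => ?_) fun i => ?_
  · exact Finset.sum_nonneg fun j _ => mul_nonneg (hinv j i) zero_le_one
  · rw [Matrix.mulVec_mulVec, ← Matrix.transpose_mul, Matrix.nonsing_inv_mul _ hu]
    simp

/-- A nonsingular `Z`-matrix is semipositive if all its positive diagonal shifts are. -/
theorem IsZMatrix.isSemipositive_of_forall_add {M : Matrix ι ι ℝ} (hM : IsZMatrix M)
    (hs : ∀ ε : ℝ, 0 < ε → IsSemipositive (M + ε • (1 : Matrix ι ι ℝ))) (hdet : M.det ≠ 0) :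
    IsSemipositive M := by
  have hu : IsUnit M.det := isUnit_iff_ne_zero.2 hdet
  set x : ι → ℝ := M⁻¹ *ᵥ 1 with hx
  have hMx : M *ᵥ x = 1 := by
    rw [hx, Matrix.mulVec_mulVec, Matrix.mul_nonsing_inv _ hu, Matrix.one_mulVec]
  -- For such ε the vector (M + εI) x = 1 + εx is nonnegative, which forces x ≥ 0.
  obtain ⟨ε, hε, hεx⟩ : ∃ ε : ℝ, 0 < ε ∧ ∀ i, 0 ≤ 1 + ε * x i := by
    have hS : 0 ≤ ∑ i, |x i| := Finset.sum_nonneg fun i _ => abs_nonneg _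
    refine ⟨1 / (1 + ∑ i, |x i|), by positivity, fun i => ?_⟩
    have h1 : |x i| ≤ ∑ i, |x i| :=
      Finset.single_le_sum (f := fun i => |x i|) (fun i _ => abs_nonneg _) (Finset.mem_univ i)
    have h2 := neg_abs_le (x i)
    have h3 : 1 + 1 / (1 + ∑ i, |x i|) * x i = (1 + ∑ i, |x i| + x i) / (1 + ∑ i, |x i|) := by
      field_simp
    rw [h3]
    apply div_nonneg <;> linarith
  refine hM.isSemipositive_of_nonneg (v := x) ?_ (by simp [hMx])
  refine (hM.add_smul_one ε).nonneg_of_mulVec_nonneg (hs ε hε) fun i => ?_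
  rw [Matrix.add_mulVec, hMx, Matrix.smul_mulVec, Matrix.one_mulVec]
  simpa using hεx i

/-- Semipositivity of `Z`-matrices with common off-diagonal entries is convex in the diagonal. -/
theorem IsZMatrix.isSemipositive_convexComb {M N : Matrix ι ι ℝ} (hM : IsZMatrix M)
    (hMN : ∀ i j, i ≠ j → M i j = N i j) (hsM : IsSemipositive M) (hsN : IsSemipositive N)
    {a b : ℝ} (ha : 0 ≤ a) (hb : 0 ≤ b) (hab : a + b = 1) :
    IsSemipositive (a • M + b • N) := by
  obtain ⟨v, hv, hMv⟩ := hsM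
  obtain ⟨w, hw, hNw⟩ := hsN
  -- The weighted geometric mean of the two witnesses works: weighted AM-GM bounds its ratios
  -- between coordinates, and the off-diagonal signs turn this into a lower bound.
  refine ⟨fun i => v i ^ a * w i ^ b,
    fun i => mul_pos (Real.rpow_pos_of_pos (hv i) _) (Real.rpow_pos_of_pos (hw i) _), fun i => ?_⟩
  have h1 := hMv i
  have h2 := hNw i
  rw [mulVec_eq_diag_add] at h1 h2 ⊢
  have hz : 0 < v i ^ a * w i ^ b :=
    mul_pos (Real.rpow_pos_of_pos (hv i) _) (Real.rpow_pos_of_pos (hw i) _)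
  have key : ∀ j, v j ^ a * w j ^ b ≤ (v i ^ a * w i ^ b) * (a * (v j / v i) + b * (w j / w i)) := by
    intro j
    have h := Real.geom_mean_le_arith_mean2_weighted ha hb (div_pos (hv j) (hv i)).le
      (div_pos (hw j) (hw i)).le hab
    rw [Real.div_rpow (hv j).le (hv i).le, Real.div_rpow (hw j).le (hw i).le, div_mul_div_comm,
      div_le_iff₀ hz] at h
    linarith
  have h3 : ∑ j ∈ Finset.univ.erase i,
      (v i ^ a * w i ^ b) * (a * (M i j * v j) / v i + b * (N i j * w j) / w i) ≤
      ∑ j ∈ Finset.univ.erase i, (a • M + b • N) i j * (v j ^ a * w j ^ b) := by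
    refine Finset.sum_le_sum fun j hj => ?_
    have hij : i ≠ j := (Finset.ne_of_mem_erase hj).symm
    have h4 : (a • M + b • N) i j = M i j := by
      simp only [Matrix.add_apply, Matrix.smul_apply, smul_eq_mul, ← hMN i j hij]
      rw [← add_mul, hab, one_mul]
    rw [h4, ← hMN i j hij]
    have := mul_le_mul_of_nonpos_left (key j) (hM i j hij)
    refine le_trans (le_of_eq ?_) this
    ring
  rw [← Finset.mul_sum, Finset.sum_add_distrib, ← Finset.sum_div, ← Finset.sum_div,
    ← Finset.mul_sum, ← Finset.mul_sum] at h3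
  have h5 : 0 < a * (M i i + (∑ j ∈ Finset.univ.erase i, M i j * v j) / v i)
      + b * (N i i + (∑ j ∈ Finset.univ.erase i, N i j * w j) / w i) := by
    have h6 : 0 < M i i + (∑ j ∈ Finset.univ.erase i, M i j * v j) / v i := by
      have := div_pos h1 (hv i)
      rwa [add_div, mul_div_cancel_right₀ _ (hv i).ne'] at this
    have h7 : 0 < N i i + (∑ j ∈ Finset.univ.erase i, N i j * w j) / w i := by
      have := div_pos h2 (hw i)
      rwa [add_div, mul_div_cancel_right₀ _ (hw i).ne'] at this
    rcases ha.eq_or_lt with h | h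
    · have : b = 1 := by linarith
      subst this
      rw [← h]
      linarith
    · have := mul_pos h h6
      have := mul_nonneg hb h7.le
      linarith
  have h8 := mul_pos hz h5
  refine lt_of_lt_of_le h8 ?_
  simp only [Matrix.add_apply, Matrix.smul_apply, smul_eq_mul] at h3 ⊢
  refine le_trans (le_of_eq ?_) (add_le_add_right h3 _)
  ring

end SemipositiveMatrices

/-! ### The pencil K - t diag(s). -/

theorem IsZMatrix.sub_smul_diagonal {ι : Type*} [DecidableEq ι] {K : Matrix ι ι ℝ} (hK : IsZMatrix K)
    (s : ι → ℝ) (t : ℝ) :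
    IsZMatrix (K - t • Matrix.diagonal s) := by
  intro i j hij
  simpa [Matrix.diagonal_apply_ne _ hij] using hK i j hij

section Pencil

variable {ι : Type*} [Fintype ι] [DecidableEq ι]

/-- The smallest eigenvalue of the `Z`-matrix `K - t diag(s)` is nonnegative. -/
def PencilNonneg (K : Matrix ι ι ℝ) (s : ι → ℝ) (t : ℝ) : Prop :=
  ∀ ε : ℝ, 0 < ε → IsSemipositive (K - t • Matrix.diagonal s + ε • (1 : Matrix ι ι ℝ))

theorem PencilNonneg.convexComb {K : Matrix ι ι ℝ} (hK : IsZMatrix K) {s : ι → ℝ} {x y : ℝ}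
    (hx : PencilNonneg K s x) (hy : PencilNonneg K s y) {a b : ℝ} (ha : 0 ≤ a) (hb : 0 ≤ b)
    (hab : a + b = 1) : PencilNonneg K s (a * x + b * y) := by
  intro ε hε
  have h := ((hK.sub_smul_diagonal s x).add_smul_one ε).isSemipositive_convexComb
    (fun i j hij => by simp [Matrix.diagonal_apply_ne _ hij]) (hx ε hε) (hy ε hε) ha hb hab
  convert h using 1
  have hb' : b = 1 - a := by linarith
  subst hb'
  module

/-- By convexity the pencil is nonnegative on the whole interval, hence semipositive wherever it is
nonsingular. Any c lies between two such points, and semipositivity is itself convex. -/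
theorem IsZMatrix.isSemipositive_pencil_of_mem_Ioo {K : Matrix ι ι ℝ} (hK : IsZMatrix K)
    {s : ι → ℝ} (hfin : {t : ℝ | (K - t • Matrix.diagonal s).det = 0}.Finite) {x y : ℝ}
    (hx : PencilNonneg K s x) (hy : PencilNonneg K s y) {c : ℝ} (hc : c ∈ Set.Ioo x y) :
    IsSemipositive (K - c • Matrix.diagonal s) := by
  have key : ∀ t ∈ Set.Ioo x y, (K - t • Matrix.diagonal s).det ≠ 0 →
      IsSemipositive (K - t • Matrix.diagonal s) := by
    intro t ht hdet
    have hxy : 0 < y - x := by linarith [ht.1, ht.2]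
    have h := hx.convexComb hK hy (a := (y - t) / (y - x)) (b := (t - x) / (y - x))
      (div_nonneg (by linarith [ht.2]) hxy.le) (div_nonneg (by linarith [ht.1]) hxy.le)
      (by field_simp; ring)
    have h2 : (y - t) / (y - x) * x + (t - x) / (y - x) * y = t := by field_simp; ring
    rw [h2] at h
    exact (hK.sub_smul_diagonal s t).isSemipositive_of_forall_add h hdet
  obtain ⟨p, hp, hp'⟩ := (Set.Ioo_infinite hc.1).exists_notMem_finite hfin
  obtain ⟨q, hq, hq'⟩ := (Set.Ioo_infinite hc.2).exists_notMem_finite hfin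
  have hsp := key p ⟨hp.1, hp.2.trans hc.2⟩ hp'
  have hsq := key q ⟨hc.1.trans hq.1, hq.2⟩ hq'
  have hpq : 0 < q - p := by linarith [hp.2, hq.1]
  have h := (hK.sub_smul_diagonal s p).isSemipositive_convexComb
    (fun i j hij => by simp [Matrix.diagonal_apply_ne _ hij]) hsp hsq
    (a := (q - c) / (q - p)) (b := (c - p) / (q - p))
    (div_nonneg (by linarith [hq.1]) hpq.le) (div_nonneg (by linarith [hp.2]) hpq.le)
    (by field_simp; ring)
  convert h using 1
  have e1 : (q - c) / (q - p) + (c - p) / (q - p) = 1 := by field_simp; ring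
  have e2 : (q - c) / (q - p) * p + (c - p) / (q - p) * q = c := by field_simp; ring
  calc K - c • Matrix.diagonal s
      = ((q - c) / (q - p) + (c - p) / (q - p)) • K
        - ((q - c) / (q - p) * p + (c - p) / (q - p) * q) • Matrix.diagonal s := by
        rw [e1, e2, one_smul]
    _ = _ := by module

theorem isSemipositive_add_smul_one {M : Matrix ι ι ℝ} {v : ι → ℝ} (hv : ∀ i, 0 < v i)
    (hMv : ∀ i, 0 ≤ (M *ᵥ v) i) {ε : ℝ} (hε : 0 < ε) :
    IsSemipositive (M + ε • (1 : Matrix ι ι ℝ)) := by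
  refine ⟨v, hv, fun i => ?_⟩
  rw [Matrix.add_mulVec, Matrix.smul_mulVec, Matrix.one_mulVec]
  exact add_pos_of_nonneg_of_pos (hMv i) (mul_pos hε (hv i))

theorem PencilNonneg.of_mulVec_eq {K : Matrix ι ι ℝ} {s : ι → ℝ} {t : ℝ} {v : ι → ℝ}
    (hv : ∀ i, 0 < v i) (h : K *ᵥ v = t • (Matrix.diagonal s *ᵥ v)) : PencilNonneg K s t := by
  intro ε hε
  refine isSemipositive_add_smul_one hv (fun i => ?_) hε
  rw [Matrix.sub_mulVec, Matrix.smul_mulVec, h, sub_self]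
  rfl

theorem PencilNonneg.of_transpose {K : Matrix ι ι ℝ} (hK : IsZMatrix K) {s : ι → ℝ} {t : ℝ}
    (h : PencilNonneg Kᵀ s t) : PencilNonneg K s t := by
  intro ε hε
  have := ((hK.transpose.sub_smul_diagonal s t).add_smul_one ε).isSemipositive_transpose (h ε hε)
  simpa using this

/-- The eigenvalues of a `Z`-matrix `M` with `M v ≥ t v` and `v > 0` have real part at
least `t`. -/
theorem IsZMatrix.le_re_of_mulVec_ge {M : Matrix ι ι ℝ} (hM : IsZMatrix M) {v : ι → ℝ}
    (hv : ∀ i, 0 < v i) {t : ℝ} (hMv : ∀ i, t * v i ≤ (M *ᵥ v) i) {μ : ℂ}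
    (hμ : (M.map Complex.ofReal - μ • (1 : Matrix ι ι ℂ)).det = 0) : t ≤ μ.re := by
  by_contra! hlt
  have hs : IsSemipositive (M + (-μ.re) • (1 : Matrix ι ι ℝ)) := by
    refine ⟨v, hv, fun i => ?_⟩
    rw [Matrix.add_mulVec, Matrix.smul_mulVec, Matrix.one_mulVec]
    have := mul_lt_mul_of_pos_right hlt (hv i)
    have := hMv i
    simp only [Pi.add_apply, Pi.smul_apply, smul_eq_mul]
    linarith
  -- M - (Re μ) I is semipositive; the remaining shift is purely imaginary.
  refine (hM.add_smul_one _).det_add_diagonal_ne_zero hs (fun _ => -(μ.im * Complex.I)) (by simp) ?_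
  convert hμ using 2
  ext i j
  rcases eq_or_ne i j with rfl | hij
  · apply Complex.ext <;> simp [sub_eq_add_neg]
  · simp [hij]

/-- The imaginary part of μ only adds a purely imaginary diagonal, whatever the signs of s. -/
theorem IsZMatrix.pencil_det_ne_zero {K : Matrix ι ι ℝ} (hK : IsZMatrix K) {s : ι → ℝ} {μ : ℂ}
    (hs : IsSemipositive (K - μ.re • Matrix.diagonal s)) :
    (K.map Complex.ofReal - μ • Matrix.diagonal (fun i => (s i : ℂ))).det ≠ 0 := by
  have h := (hK.sub_smul_diagonal s _).det_add_diagonal_ne_zero hs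
    (fun i => -(μ.im * Complex.I * s i)) (by simp)
  convert h using 2
  ext i j
  rcases eq_or_ne i j with rfl | hij
  · apply Complex.ext <;> simp [sub_eq_add_neg]
  · simp [hij]

end Pencil

/-! ### Perron theory with strict sign conditions. -/

section Perron

variable {ι : Type*} [Fintype ι]

/-- Perron's theorem for entrywise positive matrices. -/
theorem exists_pos_eigenvector_of_pos [Nonempty ι] {N : Matrix ι ι ℝ} (hN : ∀ i j, 0 < N i j) :
    ∃ (r : ℝ) (x : ι → ℝ), (∀ i, 0 < x i) ∧ N *ᵥ x = r • x := by
  classical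
  set T : ℝ := ∑ i, ∑ j, N i j with hT
  have hT0 : 0 ≤ T := Finset.sum_nonneg fun i _ => Finset.sum_nonneg fun j _ => (hN i j).le
  -- Collatz–Wielandt: maximise r subject to r x ≤ N x over the simplex. The bound T makes this set
  -- compact.
  set S : Set (ℝ × (ι → ℝ)) :=
    (Set.Icc 0 T ×ˢ stdSimplex ℝ ι) ∩ {p | ∀ i, p.1 * p.2 i ≤ (N *ᵥ p.2) i} with hS
  have hScomp : IsCompact S := by
    refine (isCompact_Icc.prod (isCompact_stdSimplex ℝ ι)).inter_right ?_
    simp only [Set.ofPred_forall]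
    refine isClosed_iInter fun i => isClosed_le (by fun_prop) ?_
    simp only [Matrix.mulVec, dotProduct]
    fun_prop
  have hpos : ∀ x : ι → ℝ, (∀ i, 0 ≤ x i) → (∃ i, x i ≠ 0) → ∀ i, 0 < (N *ᵥ x) i := by
    intro x hx ⟨k, hk⟩ i
    refine Finset.sum_pos' (fun j _ => mul_nonneg (hN i j).le (hx j))
      ⟨k, Finset.mem_univ k, mul_pos (hN i k) ((hx k).lt_of_ne hk.symm)⟩
  have hne : ∀ x ∈ stdSimplex ℝ ι, ∃ i, x i ≠ 0 := by
    intro x hx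
    by_contra! h
    have := hx.2
    simp [h] at this
  obtain ⟨e, he⟩ : (stdSimplex ℝ ι).Nonempty := ⟨_, single_mem_stdSimplex ℝ (Classical.arbitrary ι)⟩
  have hSne : S.Nonempty := by
    refine ⟨(0, e), ⟨⟨⟨le_rfl, hT0⟩, he⟩, fun i => ?_⟩⟩
    simpa using (hpos e he.1 (hne e he) i).le
  obtain ⟨⟨r, x⟩, ⟨⟨hr, hx⟩, hrx⟩, hmax⟩ := hScomp.exists_isMaxOn hSne continuous_fst.continuousOn
  simp only at hr hx hrx
  have hNx := hpos x hx.1 (hne x hx)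
  have heq : N *ᵥ x = r • x := by
    -- If N x ≠ r x, applying N to the nonzero nonnegative defect makes it positive, so y = N x
    -- admits a larger r.
    by_contra hneq
    set d : ι → ℝ := N *ᵥ x - r • x with hd
    have hd0 : ∀ i, 0 ≤ d i := fun i => by
      simpa [hd] using hrx i
    have hdne : ∃ i, d i ≠ 0 := by
      by_contra! h
      exact hneq (sub_eq_zero.1 (funext h))
    have hNd := hpos d hd0 hdne
    set y : ι → ℝ := N *ᵥ x with hy
    have hNy : N *ᵥ y = r • y + N *ᵥ d := by
      rw [hd, Matrix.mulVec_sub, Matrix.mulVec_smul, ← hy]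
      abel
    obtain ⟨k, -, hk⟩ := Finset.exists_min_image Finset.univ (fun j => (N *ᵥ d) j / y j)
      Finset.univ_nonempty
    set η := (N *ᵥ d) k / y k with hη
    have hη0 : 0 < η := div_pos (hNd k) (hNx k)
    have hge : ∀ i, (r + η) * y i ≤ (N *ᵥ y) i := by
      intro i
      have := (le_div_iff₀ (hNx i)).1 (hk i (Finset.mem_univ i))
      rw [hNy]
      simp only [Pi.add_apply, Pi.smul_apply, smul_eq_mul]
      linarith
    set Y := ∑ i, y i with hY
    have hY0 : 0 < Y := Finset.sum_pos (fun i _ => hNx i) Finset.univ_nonempty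
    have hyY : ∀ i, y i ≤ Y := fun i =>
      Finset.single_le_sum (fun j _ => (hNx j).le) (Finset.mem_univ i)
    have hrT : r + η ≤ T := by
      have h1 : (r + η) * Y ≤ T * Y := by
        rw [hY, Finset.mul_sum]
        refine (Finset.sum_le_sum fun i _ => hge i).trans ?_
        rw [hT, Finset.sum_mul]
        refine Finset.sum_le_sum fun i _ => ?_
        rw [Finset.sum_mul]
        exact Finset.sum_le_sum fun j _ => mul_le_mul_of_nonneg_left (hyY j) (hN i j).le
      exact le_of_mul_le_mul_right h1 hY0
    have hmem : (r + η, Y⁻¹ • y) ∈ S := by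
      refine ⟨⟨⟨add_nonneg hr.1 hη0.le, hrT⟩, ⟨fun i => ?_, ?_⟩⟩, fun i => ?_⟩
      · exact mul_nonneg (inv_nonneg.2 hY0.le) (hNx i).le
      · simp only [Pi.smul_apply, smul_eq_mul]
        rw [← Finset.mul_sum, ← hY, inv_mul_cancel₀ hY0.ne']
      · simp only [Matrix.mulVec_smul, Pi.smul_apply, smul_eq_mul]
        have := mul_le_mul_of_nonneg_left (hge i) (inv_nonneg.2 hY0.le)
        linarith
    have := hmax hmem
    simp only [Set.mem_ofPred_eq] at this
    linarith
  refine ⟨r, x, fun i => (hx.1 i).lt_of_ne fun h => ?_, heq⟩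
  have := hNx i
  rw [heq, Pi.smul_apply, ← h, smul_zero] at this
  exact lt_irrefl _ this

/-- A matrix with negative off-diagonal entries has a positive eigenvector. -/
theorem exists_pos_eigenvector_of_offDiag_neg [Nonempty ι] {M : Matrix ι ι ℝ}
    (hM : ∀ i j, i ≠ j → M i j < 0) :
    ∃ (r : ℝ) (x : ι → ℝ), (∀ i, 0 < x i) ∧ M *ᵥ x = r • x := by
  classical
  set s : ℝ := 1 + ∑ i, |M i i| with hs
  obtain ⟨r, x, hx, h⟩ := exists_pos_eigenvector_of_pos (N := s • (1 : Matrix ι ι ℝ) - M) (by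
    intro i j
    rcases eq_or_ne i j with rfl | hij
    · have h1 : |M i i| ≤ ∑ i, |M i i| :=
        Finset.single_le_sum (f := fun i => |M i i|) (fun i _ => abs_nonneg _) (Finset.mem_univ i)
      have h2 := le_abs_self (M i i)
      simp [hs]
      linarith
    · simpa [hij] using hM i j hij)
  refine ⟨s - r, x, hx, ?_⟩
  rw [Matrix.sub_mulVec, Matrix.smul_mulVec, Matrix.one_mulVec] at h
  rw [sub_smul, ← h, sub_sub_cancel]

variable [DecidableEq ι]

/-- A matrix with negative off-diagonal entries has a one-dimensional space of eigenvectors at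
the eigenvalue of a positive eigenvector. -/
theorem exists_eq_smul_of_offDiag_neg [Nonempty ι] {M : Matrix ι ι ℝ}
    (hM : ∀ i j, i ≠ j → M i j < 0) {p q : ι → ℝ} (hp : ∀ i, 0 < p i)
    (hMp : M *ᵥ p = 0) (hMq : M *ᵥ q = 0) : ∃ t : ℝ, q = t • p := by
  -- With the least ratio t, the vector q - t p is nonnegative and vanishes at k. Row k is then a
  -- vanishing sum of nonpositive terms with negative coefficients.
  obtain ⟨k, -, hk⟩ := Finset.exists_min_image Finset.univ (fun j => q j / p j)
    Finset.univ_nonempty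
  refine ⟨q k / p k, ?_⟩
  set t := q k / p k with ht
  have h0 : M *ᵥ (q - t • p) = 0 := by
    rw [Matrix.mulVec_sub, Matrix.mulVec_smul, hMp, hMq, smul_zero, sub_zero]
  have hnn : ∀ j, 0 ≤ (q - t • p) j := fun j => by
    have := (le_div_iff₀ (hp j)).1 (hk j (Finset.mem_univ j))
    simpa using this
  have hk0 : (q - t • p) k = 0 := by simp [ht, (hp k).ne']
  have h1 := congrFun h0 k
  rw [mulVec_eq_diag_add, hk0, mul_zero, zero_add, Pi.zero_apply,
    Finset.sum_eq_zero_iff_of_nonpos fun j hj =>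
      mul_nonpos_of_nonpos_of_nonneg (hM k j (Finset.ne_of_mem_erase hj).symm).le (hnn j)] at h1
  refine sub_eq_zero.1 (funext fun j => ?_)
  rcases eq_or_ne k j with rfl | hkj
  · exact hk0
  · exact (mul_eq_zero.1 (h1 j (Finset.mem_erase.2 ⟨hkj.symm, Finset.mem_univ j⟩))).resolve_left
      (hM k j hkj).ne

/-- If `M` has negative off-diagonal entries and the positive eigenvector `u` for `t`, then the
eigenvalues with a left eigenvector orthogonal to `u` have real part greater than `t`. -/
theorem lt_re_of_vecMul_eq_of_dotProduct_eq_zero [Nonempty ι] {M : Matrix ι ι ℝ}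
    (hM : ∀ i j, i ≠ j → M i j < 0) {u : ι → ℝ} (hu : ∀ i, 0 < u i) {t : ℝ}
    (hMu : M *ᵥ u = t • u) {μ : ℂ} {y : ι → ℂ} (hy : y ≠ 0)
    (hyM : y ᵥ* M.map Complex.ofReal = μ • y) (hyu : ∑ i, y i * u i = 0) : t < μ.re := by
  -- Add the rank-one matrix ε u 1ᵀ. Since y is orthogonal to u, its eigenvalue μ is unchanged,
  -- while the eigenvalue of u rises to t + ε ∑ u j.
  obtain ⟨ε, hε, hεM⟩ : ∃ ε : ℝ, 0 < ε ∧ ∀ i j, i ≠ j → M i j + u i * ε ≤ 0 := by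
    have h : ∀ᶠ ε in nhdsWithin (0 : ℝ) (Set.Ioi 0), ∀ i j, i ≠ j → M i j + u i * ε ≤ 0 := by
      refine Filter.eventually_all.2 fun i => Filter.eventually_all.2 fun j => ?_
      refine Filter.eventually_imp_distrib_left.2 fun hij => ?_
      have hc : Filter.Tendsto (fun ε : ℝ => M i j + u i * ε) (nhdsWithin 0 (Set.Ioi 0))
          (nhds (M i j + u i * 0)) :=
        (Continuous.tendsto (by fun_prop) 0).mono_left nhdsWithin_le_nhds
      rw [mul_zero, add_zero] at hc
      exact (hc.eventually_lt_const (hM i j hij)).mono fun ε h => h.le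
    obtain ⟨ε, h1, h2⟩ := (h.and self_mem_nhdsWithin).exists
    exact ⟨ε, h2, h1⟩
  set M' : Matrix ι ι ℝ := Matrix.of fun i j => M i j + u i * ε with hM'
  have hZ : IsZMatrix M' := fun i j hij => hεM i j hij
  have hsum : 0 < ∑ j, u j := Finset.sum_pos (fun j _ => hu j) Finset.univ_nonempty
  have hle := hZ.le_re_of_mulVec_ge hu (t := t + ε * ∑ j, u j) (fun i => le_of_eq (by
    have h := congrFun hMu i
    simp only [Matrix.mulVec, dotProduct, Pi.smul_apply, smul_eq_mul] at h
    simp only [hM', Matrix.mulVec, dotProduct, Matrix.of_apply, add_mul, Finset.sum_add_distrib, h,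
      ← Finset.mul_sum]
    ring)) (μ := μ) (Matrix.exists_vecMul_eq_zero_iff.1 ⟨y, hy, by
      rw [Matrix.vecMul_sub, Matrix.vecMul_smul, Matrix.vecMul_one, sub_eq_zero, ← hyM]
      ext j
      simp only [hM', Matrix.vecMul, dotProduct, Matrix.map_apply, Matrix.of_apply,
        Complex.ofReal_add, Complex.ofReal_mul, mul_add, Finset.sum_add_distrib, ← mul_assoc,
        ← Finset.sum_mul, hyu, zero_mul, add_zero]⟩)
  nlinarith [mul_pos hε hsum]

end Perron

/-! ### Intertwiners and common eigenvalues. -/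

section Sylvester

/-- A nonzero intertwiner `Δ` of `P` and `Q` yields a common eigenvalue, with an eigenvector of
`P` in the column space and a left eigenvector of `Q` in the row space of `Δ`. -/
theorem exists_common_eigenvalue_of_intertwine {ι κ : Type*} [Fintype ι] [Fintype κ]
    {P : Matrix κ κ ℂ} {Q : Matrix ι ι ℂ} {Δ : Matrix κ ι ℂ} (hPQ : P * Δ = Δ * Q) (hΔ : Δ ≠ 0) :
    ∃ μ : ℂ, (∃ x, Δ *ᵥ x ≠ 0 ∧ P *ᵥ (Δ *ᵥ x) = μ • (Δ *ᵥ x)) ∧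
      ∃ t, t ᵥ* Δ ≠ 0 ∧ (t ᵥ* Δ) ᵥ* Q = μ • (t ᵥ* Δ) := by
  classical
  have hV : ∀ z ∈ LinearMap.range Δ.mulVecLin, P.mulVecLin z ∈ LinearMap.range Δ.mulVecLin := by
    rintro _ ⟨x, rfl⟩
    refine ⟨Q *ᵥ x, ?_⟩
    simp only [Matrix.mulVecLin_apply, Matrix.mulVec_mulVec, hPQ]
  have hV0 : Nontrivial (LinearMap.range Δ.mulVecLin) := by
    rw [Submodule.nontrivial_iff_ne_bot, Ne, LinearMap.range_eq_bot]
    intro h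
    apply hΔ
    ext i j
    have := congrFun (LinearMap.congr_fun h (Pi.single j 1)) i
    simpa using this
  obtain ⟨μ, hμ⟩ := Module.End.exists_eigenvalue (P.mulVecLin.restrict hV)
  obtain ⟨⟨z, x, rfl⟩, hz⟩ := hμ.exists_hasEigenvector
  have hz0 : Δ *ᵥ x ≠ 0 := fun h => hz.2 (Subtype.ext h)
  have hzμ : P *ᵥ (Δ *ᵥ x) = μ • (Δ *ᵥ x) := congrArg Subtype.val hz.apply_eq_smul
  refine ⟨μ, ⟨x, hz0, hzμ⟩, ?_⟩
  -- Otherwise Q - μ is bijective on the row space of Δ, so each row of Δ has the form t Δ (Q - μ) =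
  -- t (P - μ) Δ. Such rows annihilate x, giving Δ x = 0.
  by_contra! hno
  have hPt : ∀ t, (t ᵥ* Δ) ᵥ* Q = (t ᵥ* P) ᵥ* Δ := fun t => by
    rw [Matrix.vecMul_vecMul, Matrix.vecMul_vecMul, hPQ]
  set f : (ι → ℂ) →ₗ[ℂ] (ι → ℂ) := Q.vecMulLinear - μ • LinearMap.id with hf
  have hfapp : ∀ y, f y = y ᵥ* Q - μ • y := fun y => rfl
  have hW : ∀ y ∈ LinearMap.range Δ.vecMulLinear, f y ∈ LinearMap.range Δ.vecMulLinear := by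
    rintro _ ⟨t, rfl⟩
    refine ⟨t ᵥ* P - μ • t, ?_⟩
    simp only [Matrix.vecMulLinear_apply, hfapp, hPt, Matrix.sub_vecMul, Matrix.smul_vecMul]
  have hinj : Function.Injective (f.restrict hW) := by
    rw [← LinearMap.ker_eq_bot, LinearMap.ker_eq_bot']
    rintro ⟨y, t, rfl⟩ h
    have h1 : f (t ᵥ* Δ) = 0 := congrArg Subtype.val h
    rw [hfapp, sub_eq_zero] at h1
    by_contra hy
    exact hno t (fun h => hy (Subtype.ext h)) h1
  have hsurj := LinearMap.injective_iff_surjective.1 hinj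
  apply hz0
  ext i
  obtain ⟨⟨_, t, rfl⟩, ht⟩ := hsurj ⟨(Pi.single i 1) ᵥ* Δ, ⟨_, rfl⟩⟩
  have ht' : f (t ᵥ* Δ) = Pi.single i 1 ᵥ* Δ := congrArg Subtype.val ht
  have h1 : (Pi.single i 1 ᵥ* Δ) ⬝ᵥ x = 0 := by
    rw [← ht', hfapp, hPt, sub_dotProduct, smul_dotProduct, ← Matrix.dotProduct_mulVec,
      ← Matrix.dotProduct_mulVec, ← Matrix.dotProduct_mulVec, hzμ, dotProduct_smul, sub_self]
  rw [← Matrix.dotProduct_mulVec] at h1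
  simpa using h1

end Sylvester

/-! ### Riccati solutions as invariant graphs. -/

section Riccati

variable {m n : ℕ} {A : Matrix (Fin m) (Fin m) ℝ} {B : Matrix (Fin m) (Fin n) ℝ}
  {C : Matrix (Fin n) (Fin m) ℝ} {D : Matrix (Fin n) (Fin n) ℝ} {X Y : Matrix (Fin m) (Fin n) ℝ}

/-- The signature of the matrix `diag(I, -I)` relating `riccatiK` and `riccatiH`. -/
def riccatiSign (m n : ℕ) : Fin n ⊕ Fin m → ℝ :=
  Sum.elim (fun _ => 1) (fun _ => -1)

theorem riccatiK_transpose (A : Matrix (Fin m) (Fin m) ℝ) (B : Matrix (Fin m) (Fin n) ℝ)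
    (C : Matrix (Fin n) (Fin m) ℝ) (D : Matrix (Fin n) (Fin n) ℝ) :
    (riccatiK A B C D)ᵀ = riccatiK Aᵀ Cᵀ Bᵀ Dᵀ := by
  simp [riccatiK, Matrix.fromBlocks_transpose]

theorem diagonal_riccatiSign :
    Matrix.diagonal (riccatiSign m n) = Matrix.fromBlocks 1 0 0 (-1) := by
  rw [riccatiSign, ← Matrix.fromBlocks_diagonal]
  congr 1
  ext i j
  rcases eq_or_ne i j with rfl | h <;> simp [*]

theorem riccatiH_eq : riccatiH A B C D = Matrix.diagonal (riccatiSign m n) * riccatiK A B C D := by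
  rw [diagonal_riccatiSign, riccatiH, riccatiK, Matrix.fromBlocks_multiply]
  simp

theorem diagonal_riccatiSign_mul_self :
    Matrix.diagonal (riccatiSign m n) * Matrix.diagonal (riccatiSign m n) = 1 := by
  rw [diagonal_riccatiSign, Matrix.fromBlocks_multiply]
  simp

/-- With S the signature matrix, H = S K and S² = 1 give μ - H = -S (K - μS). -/
theorem det_riccatiK_pencil_eq_zero_iff (μ : ℂ) :
    ((riccatiK A B C D).map Complex.ofReal
      - μ • Matrix.diagonal (fun i => (riccatiSign m n i : ℂ))).det = 0 ↔
    ((riccatiH A B C D).charpoly.map Complex.ofRealHom).eval μ = 0 := by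
  have hs : (Matrix.diagonal (riccatiSign m n)).map Complex.ofRealHom
      = Matrix.diagonal (fun i => (riccatiSign m n i : ℂ)) := by
    rw [Matrix.diagonal_map (map_zero _)]
    rfl
  have hss : Matrix.diagonal (fun i => (riccatiSign m n i : ℂ))
      * Matrix.diagonal (fun i => (riccatiSign m n i : ℂ)) = 1 := by
    rw [← hs, ← Matrix.map_mul, diagonal_riccatiSign_mul_self]
    simp
  have h0 : (Matrix.diagonal (fun i => (riccatiSign m n i : ℂ))).det ≠ 0 := by
    intro h
    have h2 := congrArg Matrix.det hss
    rw [Matrix.det_mul, h, zero_mul, Matrix.det_one] at h2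
    exact zero_ne_one h2
  have h1 : Matrix.scalar _ μ - (riccatiH A B C D).map Complex.ofRealHom
      = -(Matrix.diagonal (fun i => (riccatiSign m n i : ℂ)) * ((riccatiK A B C D).map Complex.ofReal
      - μ • Matrix.diagonal (fun i => (riccatiSign m n i : ℂ)))) := by
    rw [riccatiH_eq, Matrix.map_mul, hs, Matrix.mul_sub, Matrix.mul_smul, hss, neg_sub,
      Matrix.scalar_apply, Matrix.smul_one_eq_diagonal]
    rfl
  rw [← Matrix.charpoly_map, Matrix.eval_charpoly, h1, Matrix.det_neg, Matrix.det_mul,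
    mul_eq_zero, mul_eq_zero, or_iff_right (pow_ne_zero _ (by simp)), or_iff_right h0]

theorem finite_det_riccatiK_pencil_eq_zero :
    {t : ℝ | (riccatiK A B C D - t • Matrix.diagonal (riccatiSign m n)).det = 0}.Finite := by
  have hne : (riccatiH A B C D).charpoly ≠ 0 := (Matrix.charpoly_monic _).ne_zero
  refine ((riccatiH A B C D).charpoly.roots.toFinset.finite_toSet).subset fun t ht => ?_
  have ht' : (riccatiK A B C D - t • Matrix.diagonal (riccatiSign m n)).det = 0 := ht
  simp only [Finset.mem_coe, Multiset.mem_toFinset, Polynomial.mem_roots hne]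
  have h := (det_riccatiK_pencil_eq_zero_iff (A := A) (B := B) (C := C) (D := D) (t : ℂ)).1 (by
    have h1 := RingHom.map_det Complex.ofRealHom
      (riccatiK A B C D - t • Matrix.diagonal (riccatiSign m n))
    rw [ht', map_zero] at h1
    rw [h1]
    congr 1
    ext i j
    rcases eq_or_ne i j with rfl | hij
    · simp
    · simp [hij])
  rw [Polynomial.eval_map] at h
  have h2 := Polynomial.eval₂_at_apply Complex.ofRealHom t (p := (riccatiH A B C D).charpoly)
  rw [Complex.ofRealHom_eq_coe] at h2
  rw [h2] at h
  simpa using h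

/-- No eigenvalue of `riccatiH` has its real part strictly between two parameters at which the
pencil of `riccatiK` has nonnegative smallest eigenvalue. -/
theorem riccatiH_charpoly_eval_ne_zero (hK : IsZMatrix (riccatiK A B C D)) {a b : ℝ}
    (ha : PencilNonneg (riccatiK A B C D) (riccatiSign m n) a)
    (hb : PencilNonneg (riccatiK A B C D) (riccatiSign m n) b) {μ : ℂ}
    (hμ : μ.re ∈ Set.Ioo a b) :
    ((riccatiH A B C D).charpoly.map Complex.ofRealHom).eval μ ≠ 0 := fun h =>
  hK.pencil_det_ne_zero (hK.isSemipositive_pencil_of_mem_Ioo finite_det_riccatiK_pencil_eq_zero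
    ha hb hμ) ((det_riccatiK_pencil_eq_zero_iff μ).2 h)

theorem IsRiccatiSolution.eq_add (hX : IsRiccatiSolution A B C D X) :
    B = X * (D - C * X) + A * X := by
  rw [IsRiccatiSolution] at hX
  rw [← sub_eq_zero, ← neg_eq_zero, ← neg_eq_zero, ← hX]
  simp only [Matrix.mul_sub, Matrix.mul_assoc]
  abel

theorem IsRiccatiSolution.transpose (hX : IsRiccatiSolution A B C D X) :
    IsRiccatiSolution Dᵀ Bᵀ Cᵀ Aᵀ Xᵀ := by
  have := congrArg Matrix.transpose hX
  simp only [Matrix.transpose_add, Matrix.transpose_sub, Matrix.transpose_mul,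
    Matrix.transpose_zero] at this
  rw [IsRiccatiSolution, ← this, Matrix.mul_assoc]
  abel

/-- Conjugation by the unipotent block matrix with lower left block X makes H block upper
triangular; the equation says exactly that the lower left block vanishes. -/
theorem IsRiccatiSolution.charpoly_eq (hX : IsRiccatiSolution A B C D X) :
    (riccatiH A B C D).charpoly = (D - C * X).charpoly * (-(A - X * C)).charpoly := by
  have h1 : riccatiH A B C D = Matrix.fromBlocks 1 0 X 1 *
      (Matrix.fromBlocks (D - C * X) (-C) 0 (-(A - X * C)) * Matrix.fromBlocks 1 0 (-X) 1) := by
    rw [riccatiH]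
    simp only [Matrix.fromBlocks_multiply]
    congr 1
    · simp
    · simp
    · nth_rw 1 [hX.eq_add]
      simp [Matrix.mul_sub, Matrix.sub_mul, Matrix.mul_assoc]
      abel
    · simp
      abel
  rw [← Matrix.charpoly_fromBlocks_zero₂₁ (M₁₂ := -C), h1, Matrix.charpoly_mul_comm,
    Matrix.mul_assoc, Matrix.fromBlocks_multiply (A' := 1)]
  simp [Matrix.fromBlocks_one]

/-- The graph of X is H-invariant, and H acts on it as D - CX. -/
theorem IsRiccatiSolution.riccatiK_mulVec (hX : IsRiccatiSolution A B C D X) {u : Fin n → ℝ}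
    {t : ℝ} (hu : (D - C * X) *ᵥ u = t • u) :
    riccatiK A B C D *ᵥ Sum.elim u (X *ᵥ u)
      = t • (Matrix.diagonal (riccatiSign m n) *ᵥ Sum.elim u (X *ᵥ u)) := by
  rw [diagonal_riccatiSign, riccatiK, Matrix.fromBlocks_mulVec, Matrix.fromBlocks_mulVec]
  have h1 : D *ᵥ u + -C *ᵥ (X *ᵥ u) = t • u := by
    rw [← hu, Matrix.sub_mulVec, Matrix.neg_mulVec, Matrix.mulVec_mulVec, sub_eq_add_neg]
  have h2 : -B *ᵥ u + A *ᵥ (X *ᵥ u) = -(t • (X *ᵥ u)) := by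
    nth_rw 1 [hX.eq_add]
    rw [← Matrix.mulVec_smul, ← hu, Matrix.neg_mulVec, Matrix.add_mulVec, Matrix.mulVec_mulVec,
      Matrix.mulVec_mulVec]
    abel
  simp only [Sum.elim_comp_inl, Sum.elim_comp_inr]
  rw [h1, h2, Matrix.one_mulVec, Matrix.zero_mulVec, Matrix.zero_mulVec, Matrix.neg_mulVec,
    Matrix.one_mulVec, add_zero, zero_add]
  ext (i | i) <;> simp

/-- Xᵀ solves the transposed equation with A and D exchanged; t changes sign because w sits in the
block where the signature is -1. -/
theorem IsRiccatiSolution.riccatiK_transpose_mulVec (hX : IsRiccatiSolution A B C D X)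
    {w : Fin m → ℝ} {t : ℝ} (hw : (A - X * C)ᵀ *ᵥ w = t • w) :
    (riccatiK A B C D)ᵀ *ᵥ Sum.elim (Xᵀ *ᵥ w) w
      = (-t) • (Matrix.diagonal (riccatiSign m n) *ᵥ Sum.elim (Xᵀ *ᵥ w) w) := by
  rw [riccatiK_transpose, diagonal_riccatiSign, riccatiK, Matrix.fromBlocks_mulVec,
    Matrix.fromBlocks_mulVec]
  have hw' : (Aᵀ - Cᵀ * Xᵀ) *ᵥ w = t • w := by
    rw [← hw, Matrix.transpose_sub, Matrix.transpose_mul]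
  have h1 : Aᵀ *ᵥ w + -Cᵀ *ᵥ (Xᵀ *ᵥ w) = t • w := by
    rw [← hw', Matrix.sub_mulVec, Matrix.neg_mulVec, Matrix.mulVec_mulVec, sub_eq_add_neg]
  have h2 : -Bᵀ *ᵥ w + Dᵀ *ᵥ (Xᵀ *ᵥ w) = -(t • (Xᵀ *ᵥ w)) := by
    nth_rw 1 [hX.transpose.eq_add]
    rw [← Matrix.mulVec_smul, ← hw', Matrix.neg_mulVec, Matrix.add_mulVec, Matrix.mulVec_mulVec,
      Matrix.mulVec_mulVec]
    abel
  rw [add_comm] at h1 h2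
  simp only [Sum.elim_comp_inl, Sum.elim_comp_inr]
  rw [h1, h2, Matrix.one_mulVec, Matrix.zero_mulVec, Matrix.zero_mulVec, Matrix.neg_mulVec,
    Matrix.one_mulVec, add_zero, zero_add]
  ext (i | i) <;> simp

end Riccati

/-! ### Positive solutions when the off-diagonal entries of K are negative. -/

section Riccati

variable {m n : ℕ} {A : Matrix (Fin m) (Fin m) ℝ} {B : Matrix (Fin m) (Fin n) ℝ}
  {C : Matrix (Fin n) (Fin m) ℝ} {D : Matrix (Fin n) (Fin n) ℝ} {X Y Z : Matrix (Fin m) (Fin n) ℝ}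

/-- `d` and `a` are the Perron values of `D - C X` and of the transpose of `A - X C`. -/
def IsRiccatiPerronPair (A : Matrix (Fin m) (Fin m) ℝ) (C : Matrix (Fin n) (Fin m) ℝ)
    (D : Matrix (Fin n) (Fin n) ℝ) (X : Matrix (Fin m) (Fin n) ℝ) (d a : ℝ) : Prop :=
  (∃ u : Fin n → ℝ, (∀ i, 0 < u i) ∧ (D - C * X) *ᵥ u = d • u) ∧
    ∃ w : Fin m → ℝ, (∀ i, 0 < w i) ∧ (A - X * C)ᵀ *ᵥ w = a • w

theorem mulVec_pos_of_pos {ι κ : Type*} [Fintype ι] [Nonempty ι] {M : Matrix κ ι ℝ}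
    (hM : ∀ i j, 0 < M i j) {u : ι → ℝ} (hu : ∀ i, 0 < u i) (i : κ) : 0 < (M *ᵥ u) i :=
  Finset.sum_pos (fun j _ => mul_pos (hM i j) (hu j)) Finset.univ_nonempty

theorem closedLoop_offDiag_neg (hK : ∀ i j, i ≠ j → riccatiK A B C D i j < 0)
    (hX : ∀ i j, 0 < X i j) (i j : Fin n) (hij : i ≠ j) : (D - C * X) i j < 0 := by
  have h1 : D i j < 0 := hK (Sum.inl i) (Sum.inl j) (fun h => hij (Sum.inl_injective h))
  have h2 : 0 ≤ ∑ k, C i k * X k j := Finset.sum_nonneg fun k _ => mul_nonneg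
    (by simpa [riccatiK] using (hK (Sum.inl i) (Sum.inr k) (by simp)).le) (hX k j).le
  rw [Matrix.sub_apply, Matrix.mul_apply]
  linarith

theorem closedLoop_transpose_offDiag_neg (hK : ∀ i j, i ≠ j → riccatiK A B C D i j < 0)
    (hX : ∀ i j, 0 < X i j) (i j : Fin m) (hij : i ≠ j) : (A - X * C)ᵀ i j < 0 := by
  have h1 : A j i < 0 := hK (Sum.inr j) (Sum.inr i) (fun h => hij (Sum.inr_injective h).symm)
  have h2 : 0 ≤ ∑ k, X j k * C k i := Finset.sum_nonneg fun k _ => mul_nonneg (hX j k).le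
    (by simpa [riccatiK] using (hK (Sum.inl k) (Sum.inr i) (by simp)).le)
  rw [Matrix.transpose_apply, Matrix.sub_apply, Matrix.mul_apply]
  linarith

theorem exists_isRiccatiPerronPair [Nonempty (Fin m)] [Nonempty (Fin n)]
    (hK : ∀ i j, i ≠ j → riccatiK A B C D i j < 0) (hX : ∀ i j, 0 < X i j) :
    ∃ d a : ℝ, IsRiccatiPerronPair A C D X d a := by
  obtain ⟨d, u, hu, hdu⟩ := exists_pos_eigenvector_of_offDiag_neg (closedLoop_offDiag_neg hK hX)
  obtain ⟨a, w, hw, haw⟩ :=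
    exists_pos_eigenvector_of_offDiag_neg (closedLoop_transpose_offDiag_neg hK hX)
  exact ⟨d, a, ⟨u, hu, hdu⟩, w, hw, haw⟩

theorem IsRiccatiPerronPair.pencilNonneg_left [Nonempty (Fin n)] {d a : ℝ}
    (h : IsRiccatiPerronPair A C D X d a) (hXs : IsRiccatiSolution A B C D X)
    (hX : ∀ i j, 0 < X i j) : PencilNonneg (riccatiK A B C D) (riccatiSign m n) d := by
  obtain ⟨⟨u, hu, hdu⟩, -⟩ := h
  refine PencilNonneg.of_mulVec_eq (v := Sum.elim u (X *ᵥ u)) ?_ (hXs.riccatiK_mulVec hdu)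
  rintro (i | i)
  · exact hu i
  · exact mulVec_pos_of_pos hX hu i

theorem IsRiccatiPerronPair.pencilNonneg_right [Nonempty (Fin m)] {d a : ℝ}
    (h : IsRiccatiPerronPair A C D X d a) (hK : IsZMatrix (riccatiK A B C D))
    (hXs : IsRiccatiSolution A B C D X) (hX : ∀ i j, 0 < X i j) :
    PencilNonneg (riccatiK A B C D) (riccatiSign m n) (-a) := by
  obtain ⟨-, w, hw, haw⟩ := h
  refine PencilNonneg.of_transpose hK (PencilNonneg.of_mulVec_eq (v := Sum.elim (Xᵀ *ᵥ w) w) ?_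
    (hXs.riccatiK_transpose_mulVec haw))
  rintro (i | i)
  · exact mulVec_pos_of_pos (fun i j => hX j i) hw i
  · exact hw i

theorem charpoly_eval_eq_zero_of_mulVec {ι : Type*} [Fintype ι] [DecidableEq ι] {R : Type*}
    [CommRing R] [IsDomain R] {M : Matrix ι ι R} {v : ι → R} (hv : v ≠ 0) {t : R}
    (h : M *ᵥ v = t • v) : M.charpoly.eval t = 0 := by
  rw [Matrix.eval_charpoly]
  refine Matrix.exists_mulVec_eq_zero_iff.1 ⟨v, hv, ?_⟩
  rw [Matrix.sub_mulVec, h, Matrix.scalar_apply, ← Matrix.smul_one_eq_diagonal, Matrix.smul_mulVec,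
    Matrix.one_mulVec, sub_self]

theorem ne_zero_of_pos {ι : Type*} [Nonempty ι] {v : ι → ℝ} (hv : ∀ i, 0 < v i) : v ≠ 0 := by
  rintro rfl
  exact lt_irrefl _ (hv (Classical.arbitrary ι))

theorem IsRiccatiPerronPair.charpoly_eval_left [Nonempty (Fin n)] {d a : ℝ}
    (h : IsRiccatiPerronPair A C D X d a) (hXs : IsRiccatiSolution A B C D X) :
    (riccatiH A B C D).charpoly.eval d = 0 := by
  obtain ⟨⟨u, hu, hdu⟩, -⟩ := h
  rw [hXs.charpoly_eq, Polynomial.eval_mul,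
    charpoly_eval_eq_zero_of_mulVec (ne_zero_of_pos hu) hdu, zero_mul]

theorem IsRiccatiPerronPair.charpoly_eval_right [Nonempty (Fin m)] {d a : ℝ}
    (h : IsRiccatiPerronPair A C D X d a) (hXs : IsRiccatiSolution A B C D X) :
    (riccatiH A B C D).charpoly.eval (-a) = 0 := by
  obtain ⟨-, w, hw, haw⟩ := h
  rw [hXs.charpoly_eq, Polynomial.eval_mul, ← Matrix.charpoly_transpose (-(A - X * C)),
    charpoly_eval_eq_zero_of_mulVec (ne_zero_of_pos hw) (t := -a), mul_zero]
  rw [Matrix.transpose_neg, Matrix.neg_mulVec, haw, neg_smul]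

/-- Take a right eigenvector z of A - XC for a and a left eigenvector y of D - CX for d. The
Sylvester operator multiplies z yᵀ by a + d. -/
theorem IsRiccatiPerronPair.ne_neg [Nonempty (Fin m)] [Nonempty (Fin n)] {d a : ℝ}
    (h : IsRiccatiPerronPair A C D X d a)
    (hS : ∀ Δ : Matrix (Fin m) (Fin n) ℝ, (A - X * C) * Δ + Δ * (D - C * X) = 0 → Δ = 0) :
    d ≠ -a := by
  rintro rfl
  obtain ⟨⟨u, hu, hdu⟩, w, hw, haw⟩ := h
  obtain ⟨y, hy, hyd⟩ := Matrix.exists_vecMul_eq_zero_iff.2 (Matrix.exists_mulVec_eq_zero_iff.1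
    ⟨u, ne_zero_of_pos hu, show ((D - C * X) - (-a) • (1 : Matrix (Fin n) (Fin n) ℝ)) *ᵥ u = 0 by
      rw [Matrix.sub_mulVec, hdu, Matrix.smul_mulVec, Matrix.one_mulVec, sub_self]⟩)
  obtain ⟨z, hz, hza⟩ := Matrix.exists_mulVec_eq_zero_iff.2 (Matrix.exists_vecMul_eq_zero_iff.1
    ⟨w, ne_zero_of_pos hw, show w ᵥ* ((A - X * C) - a • (1 : Matrix (Fin m) (Fin m) ℝ)) = 0 by
      rw [Matrix.vecMul_sub, ← Matrix.mulVec_transpose, haw, Matrix.vecMul_smul, Matrix.vecMul_one,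
        sub_self]⟩)
  rw [Matrix.vecMul_sub, Matrix.vecMul_smul, Matrix.vecMul_one, sub_eq_zero] at hyd
  rw [Matrix.sub_mulVec, Matrix.smul_mulVec, Matrix.one_mulVec, sub_eq_zero] at hza
  have h0 := hS (Matrix.vecMulVec z y) (by
    rw [Matrix.mul_vecMulVec, Matrix.vecMulVec_mul, hyd, hza, Matrix.smul_vecMulVec,
      Matrix.vecMulVec_smul, neg_smul, add_neg_cancel])
  obtain ⟨i, hi⟩ := Function.ne_iff.1 hz
  obtain ⟨j, hj⟩ := Function.ne_iff.1 hy
  have := congrFun (congrFun h0 i) j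
  exact mul_ne_zero hi hj this

/-- Subtract the two equations; using X in one closed loop and Y in the other absorbs the quadratic
term. -/
theorem IsRiccatiSolution.intertwine (hX : IsRiccatiSolution A B C D X)
    (hY : IsRiccatiSolution A B C D Y) :
    -(A - X * C) * (Y - X) = (Y - X) * (D - C * Y) := by
  rw [← sub_eq_zero]
  have h : -(A - X * C) * (Y - X) - (Y - X) * (D - C * Y)
      = (Y * C * Y - Y * D - A * Y + B) - (X * C * X - X * D - A * X + B) := by
    simp only [Matrix.neg_mul, Matrix.sub_mul, Matrix.mul_sub, Matrix.mul_assoc]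
    abel
  rw [h]
  rw [IsRiccatiSolution] at hX hY
  rw [hX, hY, sub_zero]

theorem pencil_offDiag_neg {ι : Type*} [DecidableEq ι] {K : Matrix ι ι ℝ}
    (hK : ∀ i j, i ≠ j → K i j < 0) (s : ι → ℝ) (t : ℝ) (i j : ι) (hij : i ≠ j) :
    (K - t • Matrix.diagonal s) i j < 0 := by
  simpa [Matrix.diagonal_apply_ne _ hij] using hK i j hij

/-- (u, Xu) and (v, Yv) both lie in the kernel of K - dS, which is a line because the first vector
is positive. -/
theorem mulVec_eq_of_closedLoop [Nonempty (Fin n)]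
    (hK : ∀ i j, i ≠ j → riccatiK A B C D i j < 0) (hXs : IsRiccatiSolution A B C D X)
    (hYs : IsRiccatiSolution A B C D Y) (hX : ∀ i j, 0 < X i j) {u v : Fin n → ℝ} {d : ℝ}
    (hu : ∀ i, 0 < u i) (hdu : (D - C * X) *ᵥ u = d • u) (hdv : (D - C * Y) *ᵥ v = d • v) :
    Y *ᵥ v = X *ᵥ v := by
  obtain ⟨t, ht⟩ := exists_eq_smul_of_offDiag_neg (pencil_offDiag_neg hK (riccatiSign m n) d)
    (p := Sum.elim u (X *ᵥ u)) (q := Sum.elim v (Y *ᵥ v))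
    (by
      rintro (i | i)
      · exact hu i
      · exact mulVec_pos_of_pos hX hu i)
    (by rw [Matrix.sub_mulVec, hXs.riccatiK_mulVec hdu, Matrix.smul_mulVec, sub_self])
    (by rw [Matrix.sub_mulVec, hYs.riccatiK_mulVec hdv, Matrix.smul_mulVec, sub_self])
  have h1 : v = t • u := funext fun i => congrFun ht (Sum.inl i)
  have h2 : Y *ᵥ v = t • (X *ᵥ u) := funext fun i => congrFun ht (Sum.inr i)
  rw [h2, h1, Matrix.mulVec_smul]

theorem transpose_mulVec_eq_of_closedLoop [Nonempty (Fin m)]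
    (hK : ∀ i j, i ≠ j → riccatiK A B C D i j < 0) (hXs : IsRiccatiSolution A B C D X)
    (hYs : IsRiccatiSolution A B C D Y) (hX : ∀ i j, 0 < X i j) {u v : Fin m → ℝ} {a : ℝ}
    (hu : ∀ i, 0 < u i) (hau : (A - X * C)ᵀ *ᵥ u = a • u) (hav : (A - Y * C)ᵀ *ᵥ v = a • v) :
    Yᵀ *ᵥ v = Xᵀ *ᵥ v := by
  have hKt : ∀ i j, i ≠ j → (riccatiK A B C D)ᵀ i j < 0 := fun i j hij => hK j i hij.symm
  obtain ⟨t, ht⟩ := exists_eq_smul_of_offDiag_neg (pencil_offDiag_neg hKt (riccatiSign m n) (-a))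
    (p := Sum.elim (Xᵀ *ᵥ u) u) (q := Sum.elim (Yᵀ *ᵥ v) v)
    (by
      rintro (i | i)
      · exact mulVec_pos_of_pos (fun i j => hX j i) hu i
      · exact hu i)
    (by rw [Matrix.sub_mulVec, hXs.riccatiK_transpose_mulVec hau, Matrix.smul_mulVec, sub_self])
    (by rw [Matrix.sub_mulVec, hYs.riccatiK_transpose_mulVec hav, Matrix.smul_mulVec, sub_self])
  have h1 : v = t • u := funext fun i => congrFun ht (Sum.inr i)
  have h2 : Yᵀ *ᵥ v = t • (Xᵀ *ᵥ u) := funext fun i => congrFun ht (Sum.inl i)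
  rw [h2, h1, Matrix.mulVec_smul]

theorem isZMatrix_of_offDiag_neg {ι : Type*} {K : Matrix ι ι ℝ} (hK : ∀ i j, i ≠ j → K i j < 0) :
    IsZMatrix K := fun i j hij => (hK i j hij).le

/-- Positive solutions with the same Perron values coincide. -/
theorem IsRiccatiPerronPair.eq_of_eq [Nonempty (Fin m)] [Nonempty (Fin n)]
    (hK : ∀ i j, i ≠ j → riccatiK A B C D i j < 0) (hXs : IsRiccatiSolution A B C D X)
    (hYs : IsRiccatiSolution A B C D Y) (hX : ∀ i j, 0 < X i j) (hY : ∀ i j, 0 < Y i j) {d a : ℝ}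
    (hXp : IsRiccatiPerronPair A C D X d a) (hYp : IsRiccatiPerronPair A C D Y d a) : X = Y := by
  have hd := hXp.pencilNonneg_left hXs hX
  have ha := hXp.pencilNonneg_right (isZMatrix_of_offDiag_neg hK) hXs hX
  obtain ⟨⟨u, hu, hdu⟩, w, hw, haw⟩ := hXp
  obtain ⟨⟨u', hu', hdu'⟩, w', hw', haw'⟩ := hYp
  have hΔu : (Y - X) *ᵥ u' = 0 := by
    rw [Matrix.sub_mulVec, mulVec_eq_of_closedLoop hK hXs hYs hX hu hdu hdu', sub_self]
  have hΔw : w ᵥ* (Y - X) = 0 := by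
    rw [← Matrix.mulVec_transpose, Matrix.transpose_sub, Matrix.sub_mulVec,
      transpose_mulVec_eq_of_closedLoop hK hYs hXs hY hw' haw' haw, sub_self]
  by_contra hXY
  have hΔ0 : (Y - X).map Complex.ofRealHom ≠ 0 := by
    intro h
    apply hXY
    ext i j
    have := congrFun (congrFun h i) j
    simp only [Matrix.map_apply, Matrix.sub_apply, Complex.ofRealHom_eq_coe, Matrix.zero_apply,
      Complex.ofReal_eq_zero] at this
    linarith
  have hΔuc : (Y - X).map Complex.ofRealHom *ᵥ (fun i => (u' i : ℂ)) = 0 := by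
    ext i
    have := RingHom.map_mulVec Complex.ofRealHom (Y - X) u' i
    rw [hΔu, Pi.zero_apply, map_zero] at this
    exact this.symm
  have hΔwc : (fun i => (w i : ℂ)) ᵥ* (Y - X).map Complex.ofRealHom = 0 := by
    ext i
    have := RingHom.map_vecMul Complex.ofRealHom (Y - X) w i
    rw [hΔw, Pi.zero_apply, map_zero] at this
    exact this.symm
  -- The difference Δ = Y - X annihilates u' on the right and w on the left. Its row space is thus
  -- orthogonal to u' and its column space to w, which gives d < Re μ and a < -Re μ.
  obtain ⟨μ, ⟨x, hx0, hxμ⟩, t, ht0, htμ⟩ := exists_common_eigenvalue_of_intertwine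
    (P := (-(A - X * C)).map Complex.ofRealHom) (Q := (D - C * Y).map Complex.ofRealHom)
    (by rw [← Matrix.map_mul, ← Matrix.map_mul, hXs.intertwine hYs]) hΔ0
  have h1 : d < μ.re := by
    refine lt_re_of_vecMul_eq_of_dotProduct_eq_zero (closedLoop_offDiag_neg hK hY) hu' hdu' ht0 htμ
      ?_
    change (t ᵥ* _) ⬝ᵥ (fun i => (u' i : ℂ)) = 0
    rw [← Matrix.dotProduct_mulVec, hΔuc, dotProduct_zero]
  have h2 : a < (-μ).re := by
    refine lt_re_of_vecMul_eq_of_dotProduct_eq_zero (closedLoop_transpose_offDiag_neg hK hX) hw haw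
      hx0 ?_ ?_
    · have h3 : ((A - X * C)ᵀ).map Complex.ofReal = -((-(A - X * C)).map Complex.ofRealHom)ᵀ := by
        ext i j
        simp [Matrix.mul_apply, mul_comm]
      rw [h3, Matrix.vecMul_neg, Matrix.vecMul_transpose, hxμ, neg_smul]
    · change (_ *ᵥ x) ⬝ᵥ (fun i => (w i : ℂ)) = 0
      rw [dotProduct_comm, Matrix.dotProduct_mulVec, hΔwc, zero_dotProduct]
  rw [Complex.neg_re] at h2
  refine riccatiH_charpoly_eval_ne_zero (isZMatrix_of_offDiag_neg hK) hd ha (μ := μ)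
    ⟨h1, by linarith⟩ ?_
  rw [hXs.charpoly_eq, Polynomial.map_mul, Polynomial.eval_mul, ← Matrix.charpoly_map,
    ← Matrix.charpoly_map, charpoly_eval_eq_zero_of_mulVec hx0 hxμ, mul_zero]

/-- There are no three distinct nondegenerate positive solutions if `riccatiK` has negative
off-diagonal entries. -/
theorem not_injective_of_offDiag_neg [Nonempty (Fin m)] [Nonempty (Fin n)]
    (hK : ∀ i j, i ≠ j → riccatiK A B C D i j < 0)
    {X : Fin 3 → Matrix (Fin m) (Fin n) ℝ} (hXs : ∀ k, IsRiccatiSolution A B C D (X k))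
    (hX : ∀ k i j, 0 < X k i j)
    (hS : ∀ k, ∀ Δ : Matrix (Fin m) (Fin n) ℝ,
      (A - X k * C) * Δ + Δ * (D - C * X k) = 0 → Δ = 0) : ¬ Function.Injective X := by
  choose d a hp using fun k => exists_isRiccatiPerronPair hK (hX k)
  have hZ := isZMatrix_of_offDiag_neg hK
  set V : Set ℝ := {t | PencilNonneg (riccatiK A B C D) (riccatiSign m n) t ∧
    (riccatiH A B C D).charpoly.eval t = 0} with hV
  have hdV : ∀ k, d k ∈ V := fun k =>
    ⟨(hp k).pencilNonneg_left (hXs k) (hX k), (hp k).charpoly_eval_left (hXs k)⟩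
  have haV : ∀ k, -a k ∈ V := fun k =>
    ⟨(hp k).pencilNonneg_right hZ (hXs k) (hX k), (hp k).charpoly_eval_right (hXs k)⟩
  have hne : ∀ k, d k ≠ -a k := fun k => (hp k).ne_neg (hS k)
  -- A middle point would be an eigenvalue of H strictly between two admissible parameters, so V has
  -- at most two elements.
  have hmid : ∀ x ∈ V, ∀ y ∈ V, ∀ z ∈ V, x < y → ¬ y < z := by
    intro x hx y hy z hz hxy hyz
    refine riccatiH_charpoly_eval_ne_zero hZ hx.1 hz.1 (μ := (y : ℂ)) ⟨hxy, hyz⟩ ?_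
    rw [Polynomial.eval_map]
    have h2 := Polynomial.eval₂_at_apply Complex.ofRealHom y (p := (riccatiH A B C D).charpoly)
    rw [Complex.ofRealHom_eq_coe] at h2
    rw [h2, hy.2, map_zero]
  have htwo : ∀ x ∈ V, ∀ y ∈ V, ∀ z ∈ V, x ≠ y → z = x ∨ z = y := by
    intro x hx y hy z hz hxy
    by_contra! h
    rcases lt_or_gt_of_ne hxy with h1 | h1 <;> rcases lt_or_gt_of_ne h.1 with h2 | h2 <;>
      rcases lt_or_gt_of_ne h.2 with h3 | h3
    all_goals first
      | exact hmid _ hz _ hx _ hy (by assumption) (by assumption)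
      | exact hmid _ hz _ hy _ hx (by assumption) (by assumption)
      | exact hmid _ hx _ hz _ hy (by assumption) (by assumption)
      | exact hmid _ hy _ hz _ hx (by assumption) (by assumption)
      | exact hmid _ hx _ hy _ hz (by assumption) (by assumption)
      | exact hmid _ hy _ hx _ hz (by assumption) (by assumption)
  -- As d k ≠ -a k, these two numbers exhaust V, and the first fixes the second.
  have hpair : ∀ k l, d k = d l → X k = X l := by
    intro k l hkl
    have hal : a k = a l := by
      rcases htwo _ (hdV k) _ (haV k) _ (haV l) (hne k) with h | h
      · exact absurd (h.trans hkl).symm (hne l)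
      · linarith
    exact IsRiccatiPerronPair.eq_of_eq hK (hXs k) (hXs l) (hX k) (hX l) (hp k)
      (by rw [hkl, hal]; exact hp l)
  intro hinj
  have hdinj : ∀ k l, k ≠ l → d k ≠ d l := fun k l hkl h => hkl (hinj (hpair k l h))
  rcases htwo _ (hdV 0) _ (hdV 1) _ (hdV 2) (hdinj 0 1 (by decide)) with h | h
  · exact hdinj 2 0 (by decide) h
  · exact hdinj 2 1 (by decide) h

end Riccati

/-! ### Persistence of nondegenerate solutions. -/

section Perturbation

variable {m n : ℕ}

/-- The residual of the Riccati equation whose coefficient matrix `riccatiK` has been decreased by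
`p.1` in every entry, at the matrix `p.2`. -/
def riccatiResidual (A : Matrix (Fin m) (Fin m) ℝ) (B : Matrix (Fin m) (Fin n) ℝ)
    (C : Matrix (Fin n) (Fin m) ℝ) (D : Matrix (Fin n) (Fin n) ℝ)
    (p : ℝ × (Fin m → Fin n → ℝ)) : Fin m → Fin n → ℝ :=
  Matrix.of p.2 * (C + Matrix.of fun _ _ => p.1) * Matrix.of p.2
    - Matrix.of p.2 * (D - Matrix.of fun _ _ => p.1)
    - (A - Matrix.of fun _ _ => p.1) * Matrix.of p.2 + (B + Matrix.of fun _ _ => p.1)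

variable (A : Matrix (Fin m) (Fin m) ℝ) (B : Matrix (Fin m) (Fin n) ℝ)
  (C : Matrix (Fin n) (Fin m) ℝ) (D : Matrix (Fin n) (Fin n) ℝ)

theorem contDiff_riccatiResidual : ContDiff ℝ 1 (riccatiResidual A B C D) := by
  refine contDiff_pi.2 fun i => contDiff_pi.2 fun j => ?_
  have h : (fun p => riccatiResidual A B C D p i j) = fun p : ℝ × (Fin m → Fin n → ℝ) =>
      ∑ k, (∑ l, p.2 i l * (C l k + p.1)) * p.2 k j - ∑ k, p.2 i k * (D k j - p.1)
        - ∑ k, (A i k - p.1) * p.2 k j + (B i j + p.1) := by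
    rfl
  rw [h]
  fun_prop

/-- The residual is exactly quadratic along (0, Δ); its linear coefficient is minus the Sylvester
operator. -/
theorem fderiv_riccatiResidual_inr (p : ℝ × (Fin m → Fin n → ℝ)) (Δ : Fin m → Fin n → ℝ) :
    fderiv ℝ (riccatiResidual A B C D) p (0, Δ) =
      -((A - Matrix.of (fun _ _ => p.1) - Matrix.of p.2 * (C + Matrix.of fun _ _ => p.1))
          * Matrix.of Δ
        + Matrix.of Δ * (D - Matrix.of (fun _ _ => p.1)
          - (C + Matrix.of fun _ _ => p.1) * Matrix.of p.2)) := by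
  have hd : HasFDerivAt (riccatiResidual A B C D) (fderiv ℝ (riccatiResidual A B C D) p)
      (p + (0 : ℝ) • (0, Δ)) := by
    rw [zero_smul, add_zero]
    exact ((contDiff_riccatiResidual A B C D).differentiable one_ne_zero p).hasFDerivAt
  have hl : HasDerivAt (fun t : ℝ => p + t • ((0 : ℝ), Δ)) (0, Δ) 0 := by
    simpa using ((hasDerivAt_id (0 : ℝ)).smul_const ((0 : ℝ), Δ)).const_add p
  have h1 := hd.comp_hasDerivAt (0 : ℝ) hl
  have h2 : riccatiResidual A B C D ∘ (fun t : ℝ => p + t • ((0 : ℝ), Δ)) = fun t : ℝ =>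
      riccatiResidual A B C D p + t • (-((A - Matrix.of (fun _ _ => p.1)
          - Matrix.of p.2 * (C + Matrix.of fun _ _ => p.1)) * Matrix.of Δ
        + Matrix.of Δ * (D - Matrix.of (fun _ _ => p.1)
          - (C + Matrix.of fun _ _ => p.1) * Matrix.of p.2)) : Fin m → Fin n → ℝ)
      + t ^ 2 • (Matrix.of Δ * (C + Matrix.of fun _ _ => p.1) * Matrix.of Δ :
          Fin m → Fin n → ℝ) := by
    funext t
    simp only [Function.comp_apply, riccatiResidual, Prod.fst_add, Prod.snd_add, Prod.smul_mk,
      smul_zero, add_zero]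
    generalize (Matrix.of fun _ _ => p.1 : Matrix (Fin n) (Fin m) ℝ) = E₁
    generalize (Matrix.of fun _ _ => p.1 : Matrix (Fin n) (Fin n) ℝ) = E₂
    generalize (Matrix.of fun _ _ => p.1 : Matrix (Fin m) (Fin m) ℝ) = E₃
    generalize (Matrix.of fun _ _ => p.1 : Matrix (Fin m) (Fin n) ℝ) = E₄
    change (Matrix.of p.2 + t • Matrix.of Δ) * (C + E₁) * (Matrix.of p.2 + t • Matrix.of Δ)
      - (Matrix.of p.2 + t • Matrix.of Δ) * (D - E₂) - (A - E₃) * (Matrix.of p.2 + t • Matrix.of Δ)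
      + (B + E₄) = (Matrix.of p.2 * (C + E₁) * Matrix.of p.2 - Matrix.of p.2 * (D - E₂)
      - (A - E₃) * Matrix.of p.2 + (B + E₄)) + t • (-((A - E₃ - Matrix.of p.2 * (C + E₁))
        * Matrix.of Δ + Matrix.of Δ * (D - E₂ - (C + E₁) * Matrix.of p.2)))
      + t ^ 2 • (Matrix.of Δ * (C + E₁) * Matrix.of Δ)
    generalize C + E₁ = C'
    generalize A - E₃ = A'
    generalize D - E₂ = D'
    simp only [Matrix.add_mul, Matrix.mul_add, Matrix.sub_mul, Matrix.mul_sub, Matrix.smul_mul,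
      Matrix.mul_smul, Matrix.mul_assoc]
    module
  rw [h2] at h1
  refine h1.unique ?_
  have h3 := (((hasDerivAt_id (0 : ℝ)).smul_const (-((A - Matrix.of (fun _ _ => p.1)
          - Matrix.of p.2 * (C + Matrix.of fun _ _ => p.1)) * Matrix.of Δ
        + Matrix.of Δ * (D - Matrix.of (fun _ _ => p.1)
          - (C + Matrix.of fun _ _ => p.1) * Matrix.of p.2)) : Fin m → Fin n → ℝ)).const_add
      (riccatiResidual A B C D p)).add (((hasDerivAt_id (0 : ℝ)).pow 2).smul_const
      (Matrix.of Δ * (C + Matrix.of fun _ _ => p.1) * Matrix.of Δ : Fin m → Fin n → ℝ))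
  exact h3.congr_deriv (by simp)

/-- Expresses nondegeneracy as nonvanishing of a continuous function, hence as an open condition. -/
theorem det_ne_zero_iff_forall_eq_zero {V : Type*} [NormedAddCommGroup V] [NormedSpace ℝ V]
    [FiniteDimensional ℝ V] (L : V →L[ℝ] V) : L.det ≠ 0 ↔ ∀ x, L x = 0 → x = 0 := by
  rw [← isUnit_iff_ne_zero, ContinuousLinearMap.det, ← LinearMap.isUnit_iff_isUnit_det,
    LinearMap.isUnit_iff_ker_eq_bot, LinearMap.ker_eq_bot']
  rfl

variable {A B C D}

/-- A nondegenerate solution of the Riccati equation persists, nearby and nondegenerate, when all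
entries of `riccatiK` are decreased slightly. -/
theorem IsRiccatiSolution.eventually_exists_perturbed {X : Matrix (Fin m) (Fin n) ℝ}
    (hX : IsRiccatiSolution A B C D X)
    (hS : ∀ Δ : Matrix (Fin m) (Fin n) ℝ, (A - X * C) * Δ + Δ * (D - C * X) = 0 → Δ = 0)
    {U : Set (Fin m → Fin n → ℝ)} (hU : U ∈ nhds (X : Fin m → Fin n → ℝ)) :
    ∀ᶠ ε in nhds (0 : ℝ), ∃ Y ∈ U,
      IsRiccatiSolution (A - Matrix.of fun _ _ => ε) (B + Matrix.of fun _ _ => ε)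
        (C + Matrix.of fun _ _ => ε) (D - Matrix.of fun _ _ => ε) (Matrix.of Y) ∧
      ∀ Δ : Matrix (Fin m) (Fin n) ℝ,
        ((A - Matrix.of fun _ _ => ε) - Matrix.of Y * (C + Matrix.of fun _ _ => ε)) * Δ
        + Δ * ((D - Matrix.of fun _ _ => ε) - (C + Matrix.of fun _ _ => ε) * Matrix.of Y) = 0 →
          Δ = 0 := by
  set X₀ : Fin m → Fin n → ℝ := X with hX₀
  set f := riccatiResidual A B C D with hf
  have hfc : ContDiff ℝ 1 f := contDiff_riccatiResidual A B C D
  set L : ℝ × (Fin m → Fin n → ℝ) → (Fin m → Fin n → ℝ) →L[ℝ] (Fin m → Fin n → ℝ) :=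
    fun p => (fderiv ℝ f p).comp (ContinuousLinearMap.inr ℝ ℝ (Fin m → Fin n → ℝ)) with hL
  have hLc : Continuous L := (hfc.continuous_fderiv one_ne_zero).clm_comp continuous_const
  have hLiff : ∀ p, (L p).det ≠ 0 ↔ ∀ Δ : Matrix (Fin m) (Fin n) ℝ,
      ((A - Matrix.of fun _ _ => p.1) - Matrix.of p.2 * (C + Matrix.of fun _ _ => p.1)) * Δ
        + Δ * ((D - Matrix.of fun _ _ => p.1) - (C + Matrix.of fun _ _ => p.1) * Matrix.of p.2) = 0
        → Δ = 0 := by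
    intro p
    rw [det_ne_zero_iff_forall_eq_zero]
    refine forall_congr' fun Δ => imp_congr_left ?_
    have h := fderiv_riccatiResidual_inr A B C D p Δ
    change fderiv ℝ f p (0, Δ) = 0 ↔ _
    rw [h]
    exact neg_eq_zero
  have h00 : ∀ (a b : ℕ), (Matrix.of fun _ _ => (0 : ℝ) : Matrix (Fin a) (Fin b) ℝ) = 0 :=
    fun _ _ => rfl
  have hL0 : (L (0, X₀)).det ≠ 0 := by
    rw [hLiff]
    simp only [h00, sub_zero, add_zero]
    exact hS
  have hf0 : f (0, X₀) = 0 := by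
    simp only [hf, riccatiResidual, h00, sub_zero, add_zero]
    exact hX
  have hstrict : HasStrictFDerivAt f (fderiv ℝ f (0, X₀)) (0, X₀) :=
    hfc.contDiffAt.hasStrictFDerivAt one_ne_zero
  -- The map (ε, Y) ↦ (ε, f (ε, Y)) has surjective derivative at (0, X₀), so it sends neighbourhoods
  -- to neighbourhoods of (0, 0). These contain (ε, 0) for small ε.
  have hG := hasStrictFDerivAt_fst (𝕜 := ℝ) (p := ((0 : ℝ), X₀)) |>.prodMk hstrict
  have hsurj : Function.Surjective (L (0, X₀)) := by
    have : Function.Injective (L (0, X₀) : (Fin m → Fin n → ℝ) →ₗ[ℝ] (Fin m → Fin n → ℝ)) := by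
      rw [← LinearMap.ker_eq_bot, LinearMap.ker_eq_bot']
      exact (det_ne_zero_iff_forall_eq_zero _).1 hL0
    exact LinearMap.injective_iff_surjective.1 this
  have hmap := hG.map_nhds_eq_of_surj (by
    rw [LinearMap.range_eq_top]
    rintro ⟨a, b⟩
    obtain ⟨Δ, hΔ⟩ := hsurj (b - fderiv ℝ f (0, X₀) (a, 0))
    refine ⟨(a, Δ), Prod.ext rfl ?_⟩
    change fderiv ℝ f (0, X₀) (a, Δ) = b
    have h1 : (a, Δ) = ((a, 0) : ℝ × (Fin m → Fin n → ℝ)) + (0, Δ) := by simp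
    have h2 : fderiv ℝ f (0, X₀) (0, Δ) = b - fderiv ℝ f (0, X₀) (a, 0) := hΔ
    rw [h1, map_add, h2, add_sub_cancel])
  have hW : {p : ℝ × (Fin m → Fin n → ℝ) | p.2 ∈ U ∧ (L p).det ≠ 0} ∈ nhds ((0 : ℝ), X₀) := by
    refine Filter.inter_mem (continuous_snd.continuousAt.preimage_mem_nhds hU) ?_
    exact (ContinuousLinearMap.continuous_det.comp hLc).continuousAt.eventually_ne hL0
  have himg := Filter.image_mem_map (m := fun p : ℝ × (Fin m → Fin n → ℝ) => (p.1, f p)) hW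
  rw [hmap, hf0] at himg
  have hcont : Filter.Tendsto (fun ε : ℝ => (ε, (0 : Fin m → Fin n → ℝ))) (nhds 0)
      (nhds (0, 0)) := Continuous.tendsto (by fun_prop) 0
  filter_upwards [hcont himg] with ε hε
  obtain ⟨⟨ε', Y⟩, ⟨hYU, hYL⟩, hY⟩ := hε
  obtain ⟨rfl, hY0⟩ := Prod.ext_iff.1 hY
  exact ⟨Y, hYU, hY0, (hLiff _).1 hYL⟩

/-- A nonzero kernel element yields a common eigenvalue of D - CX and -(A - XC). It is then a
multiple root of the product of their characteristic polynomials, which is that of H. -/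
theorem HasSimpleEigenvalues.sylvester_injective (hH : HasSimpleEigenvalues (riccatiH A B C D))
    {X : Matrix (Fin m) (Fin n) ℝ} (hX : IsRiccatiSolution A B C D X)
    (Δ : Matrix (Fin m) (Fin n) ℝ) (hΔ : (A - X * C) * Δ + Δ * (D - C * X) = 0) : Δ = 0 := by
  by_contra hne
  have hΔ0 : Δ.map Complex.ofRealHom ≠ 0 := by
    intro h
    apply hne
    ext i j
    simpa using congrFun (congrFun h i) j
  obtain ⟨μ, ⟨x, hx0, hxμ⟩, t, ht0, htμ⟩ := exists_common_eigenvalue_of_intertwine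
    (P := (-(A - X * C)).map Complex.ofRealHom) (Q := (D - C * X).map Complex.ofRealHom)
    (by rw [← Matrix.map_mul, ← Matrix.map_mul, Matrix.neg_mul, neg_eq_of_add_eq_zero_right hΔ])
    hΔ0
  have hfac : ((riccatiH A B C D).map Complex.ofReal).charpoly
      = ((D - C * X).map Complex.ofRealHom).charpoly
        * ((-(A - X * C)).map Complex.ofRealHom).charpoly := by
    have := Matrix.charpoly_map (riccatiH A B C D) Complex.ofRealHom
    rw [hX.charpoly_eq, Polynomial.map_mul, ← Matrix.charpoly_map, ← Matrix.charpoly_map] at this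
    exact this
  have h1 : ((-(A - X * C)).map Complex.ofRealHom).charpoly.IsRoot μ :=
    charpoly_eval_eq_zero_of_mulVec hx0 hxμ
  have h2 : ((D - C * X).map Complex.ofRealHom).charpoly.IsRoot μ := by
    rw [← Matrix.charpoly_transpose]
    exact charpoly_eval_eq_zero_of_mulVec ht0 (by rw [Matrix.mulVec_transpose, htμ])
  have h0 : ((riccatiH A B C D).map Complex.ofReal).charpoly ≠ 0 :=
    (Matrix.charpoly_monic _).ne_zero
  have hroot : ((riccatiH A B C D).map Complex.ofReal).charpoly.IsRoot μ := by
    rw [hfac, Polynomial.IsRoot, Polynomial.eval_mul, h1, mul_zero]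
  have h3 := hH μ (Matrix.mem_spectrum_iff_isRoot_charpoly.2 hroot)
  rw [hfac] at h0 h3
  rw [Polynomial.rootMultiplicity_mul h0] at h3
  have h4 := (Polynomial.rootMultiplicity_pos (left_ne_zero_of_mul h0)).2 h2
  have h5 := (Polynomial.rootMultiplicity_pos (right_ne_zero_of_mul h0)).2 h1
  omega

end Perturbation

/-! ### Reduction to negative off-diagonal entries. -/

theorem riccatiK_perturbed_offDiag_neg {m n : ℕ}
    {A : Matrix (Fin m) (Fin m) ℝ} {B : Matrix (Fin m) (Fin n) ℝ}
    {C : Matrix (Fin n) (Fin m) ℝ} {D : Matrix (Fin n) (Fin n) ℝ}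
    (hK : IsZMatrix (riccatiK A B C D)) {ε : ℝ} (hε : 0 < ε) (i j : Fin n ⊕ Fin m) (hij : i ≠ j) :
    riccatiK (A - Matrix.of fun _ _ => ε) (B + Matrix.of fun _ _ => ε)
        (C + Matrix.of fun _ _ => ε) (D - Matrix.of fun _ _ => ε) i j < 0 := by
  have h := hK i j hij
  rcases i with i | i <;> rcases j with j | j <;> simp [riccatiK] at h ⊢ <;> linarith

theorem mainTheorem9 (m n : ℕ)
    (A : Matrix (Fin m) (Fin m) ℝ) (B : Matrix (Fin m) (Fin n) ℝ)
    (C : Matrix (Fin n) (Fin m) ℝ) (D : Matrix (Fin n) (Fin n) ℝ)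
    (hK : IsRegularMMatrix (riccatiK A B C D))
    (hH : HasSimpleEigenvalues (riccatiH A B C D)) :
    Set.encard {X : Matrix (Fin m) (Fin n) ℝ |
      IsRiccatiSolution A B C D X ∧ ∀ i j, 0 < X i j} ≤ 2 := by
  by_contra! hlt
  obtain ⟨T, hT, hT3⟩ := Set.exists_subset_encard_eq (k := 3)
    (show (3 : ℕ∞) ≤ _ from Order.add_one_le_of_lt hlt)
  obtain ⟨x, y, z, hxy, hxz, hyz, rfl⟩ := Set.encard_eq_three.1 hT3
  rcases isEmpty_or_nonempty (Fin m) with hm | hm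
  · exact hxy (Subsingleton.elim _ _)
  rcases isEmpty_or_nonempty (Fin n) with hn | hn
  · exact hxy (Subsingleton.elim _ _)
  set X : Fin 3 → Fin m → Fin n → ℝ := ![x, y, z] with hXdef
  have hX : ∀ k, IsRiccatiSolution A B C D (X k) ∧ ∀ i j, 0 < X k i j := by
    intro k
    fin_cases k
    · exact hT (Or.inl rfl)
    · exact hT (Or.inr (Or.inl rfl))
    · exact hT (Or.inr (Or.inr rfl))
  have hinj : Function.Injective X := by
    intro k l hkl
    fin_cases k <;> fin_cases l <;> first | rfl | exact absurd hkl (by assumption) |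
      exact absurd hkl.symm (by assumption)
  -- Disjoint neighbourhoods keep the three perturbed solutions distinct.
  obtain ⟨U, hU, hUd⟩ := (Set.finite_range X).t2_separation
  have hpos : ∀ k, {Y : Fin m → Fin n → ℝ | ∀ i j, 0 < Y i j} ∈ nhds (X k) := by
    intro k
    refine Filter.eventually_all.2 fun i => Filter.eventually_all.2 fun j => ?_
    exact (Continuous.tendsto (f := fun Y : Fin m → Fin n → ℝ => Y i j) (by fun_prop)
      (X k)).eventually_const_lt ((hX k).2 i j)
  have hev : ∀ᶠ ε in nhdsWithin (0 : ℝ) (Set.Ioi 0), ∀ k, ∃ Y ∈ U (X k) ∩ {Y | ∀ i j, 0 < Y i j},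
      IsRiccatiSolution (A - Matrix.of fun _ _ => ε) (B + Matrix.of fun _ _ => ε)
        (C + Matrix.of fun _ _ => ε) (D - Matrix.of fun _ _ => ε) (Matrix.of Y) ∧
      ∀ Δ : Matrix (Fin m) (Fin n) ℝ,
        ((A - Matrix.of fun _ _ => ε) - Matrix.of Y * (C + Matrix.of fun _ _ => ε)) * Δ
        + Δ * ((D - Matrix.of fun _ _ => ε) - (C + Matrix.of fun _ _ => ε) * Matrix.of Y) = 0 →
          Δ = 0 :=
    Filter.eventually_all.2 fun k => ((hX k).1.eventually_exists_perturbed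
      (hH.sylvester_injective (hX k).1) (Filter.inter_mem ((hU (X k)).2.mem_nhds (hU (X k)).1)
        (hpos k))).filter_mono nhdsWithin_le_nhds
  obtain ⟨ε, hε, hε0⟩ := (hev.and self_mem_nhdsWithin).exists
  choose Y hYU hYs hYS using hε
  refine not_injective_of_offDiag_neg (X := fun k => Matrix.of (Y k))
    (riccatiK_perturbed_offDiag_neg hK.1.1 hε0) hYs (fun k => (hYU k).2) hYS ?_
  intro k l hkl
  by_contra hne
  have hkl' : Y k = Y l := hkl
  have hdis := hUd (Set.mem_range_self k) (Set.mem_range_self l) (hinj.ne hne)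
  exact Set.disjoint_left.1 hdis (hYU k).1 (by rw [hkl']; exact (hYU l).1)
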